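/- Let $A$ be an associative ring with unit, $\mathcal C$ an $A$-coring with coproduct $\Delta$ and counit $\varepsilon$, and let ${\bf M}^{\mathcal C}$ be the category of right $\mathcal C$-comodules. Let $P\in{\bf M}^{\mathcal C}$ with coaction $\varrho^P:P\to P\otimes_A\mathcal C$, let $S={\rm End}^{\mathcal C}(P)$ be its ring of colinear endomorphisms (acting on $P$ from the left), and let ${\bf M}_S$ be the category of right $S$-modules. Assume that $P$ is finitely generated and projective as a right $A$-module and that $P$ is a Galois comodule, i.e. for every right $A$-module $K$ the map $${\rm Hom}_A(P,K)\otimes_S P\to K\otimes_A\mathcal C,\qquad g\otimes p\mapsto (g\otimes I_{\mathcal C})\varrho^P(p),$$ is an isomorphism. Regard $P^*={\rm Hom}_A(P,A)$ as a left $\mathcal C$-comodule, where the coaction sends $g\in P^*$ to the element of $\mathcal C\otimes_A P^*$ that corresponds to $(g\otimes I_{\mathcal C})\varrho^P\in{\rm Hom}_A(P,\mathcal C)$ under the isomorphism $\mathcal C\otimes_AP^*\to{\rm Hom}_A(P,\mathcal C)$, $c\otimes h\mapsto c\,h(-)$. Then $${\rm Hom}^{\mathcal C}(P,-):{\bf M}^{\mathcal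 C}\to{\bf M}_S$$ is an equivalence of categories with inverse functor $-\otimes_SP$ in each of the following cases: (i) $P$ is strongly $(\mathcal C,A)$-injective, i.e. $\varrho^P$ is split by a map $P\otimes_A\mathcal C\to P$ that is right $\mathcal C$-colinear and left $S$-linear; (ii) $P^*$ is $(\mathcal C,A)$-injective, i.e. its coaction $P^*\to\mathcal C\otimes_AP^*$ is split by a left $\mathcal C$-colinear map, and ${}_SP$ is flat; (iii) $P^*$ is coflat, i.e. the cotensor product $-\otimes^{\mathcal C}P^*$ sends short exact sequences of right $\mathcal C$-comodules (colinear maps forming a short exact sequence of $A$-modules) to short exact sequences of abelian groups, and ${}_SP$ is flat; (iv) $\mathcal C$ is coseparable, i.e. $\Delta$ is split by an $(A,A)$-bilinear map $\mathcal C\otimes_A\mathcal C\to\mathcal C$ that is left and right $\mathcal C$-colinear. -/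

import Mathlib

open CategoryTheory

universe u v w

/-! ## Tensor products over a noncommutative ring

Right `R`-modules are modules over `Rᵐᵒᵖ`. -/

section BalTensor

/-- The tensor product `M ⊗_R N` of a right `R`-module `M` and a left `R`-module `N`: the quotient
of `M ⊗_ℤ N` by the subgroup generated by the elements `m r ⊗ n - m ⊗ r n`. -/
def BalTensor (R : Type*) (M : Type*) (N : Type*) [Ring R] [AddCommGroup M] [Module Rᵐᵒᵖ M]
    [AddCommGroup N] [Module R N] : Type _ :=
  TensorProduct ℤ M N ⧸ AddSubgroup.closure {t : TensorProduct ℤ M N | ∃ (m : M) (r : R) (n : N),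
    t = TensorProduct.tmul ℤ (MulOpposite.op r • m) n - TensorProduct.tmul ℤ m (r • n)}

namespace BalTensor

variable (R : Type*) [Ring R]
variable {M : Type*} [AddCommGroup M] [Module Rᵐᵒᵖ M]
variable {N : Type*} [AddCommGroup N] [Module R N]
variable {M' : Type*} [AddCommGroup M'] [Module Rᵐᵒᵖ M']
variable {N' : Type*} [AddCommGroup N'] [Module R N']
variable {Q : Type*} [AddCommGroup Q]

instance instAddCommGroup : AddCommGroup (BalTensor R M N) :=
  inferInstanceAs (AddCommGroup (TensorProduct ℤ M N ⧸ AddSubgroup.closure _))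

/-- The pure tensor `m ⊗ n`. -/
def tmul (m : M) (n : N) : BalTensor R M N :=
  QuotientAddGroup.mk (TensorProduct.tmul ℤ m n)

theorem add_tmul (m m' : M) (n : N) : tmul R (m + m') n = tmul R m n + tmul R m' n :=
  congrArg QuotientAddGroup.mk (TensorProduct.add_tmul m m' n)

theorem tmul_add (m : M) (n n' : N) : tmul R m (n + n') = tmul R m n + tmul R m n' :=
  congrArg QuotientAddGroup.mk (TensorProduct.tmul_add m n n')

theorem zero_tmul (n : N) : tmul R (0 : M) n = 0 :=
  congrArg QuotientAddGroup.mk (TensorProduct.zero_tmul M n)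

theorem tmul_zero (m : M) : tmul R m (0 : N) = 0 :=
  congrArg QuotientAddGroup.mk (TensorProduct.tmul_zero N m)

theorem smul_tmul (r : R) (m : M) (n : N) :
    tmul R (MulOpposite.op r • m) n = tmul R m (r • n) := by
  refine (QuotientAddGroup.eq_iff_sub_mem).2 (AddSubgroup.subset_closure ⟨m, r, n, rfl⟩)

variable {R}

theorem induction_on {p : BalTensor R M N → Prop} (t : BalTensor R M N)
    (hz : p 0) (ht : ∀ m n, p (tmul R m n)) (ha : ∀ x y, p x → p y → p (x + y)) : p t := by
  obtain ⟨t, rfl⟩ := QuotientAddGroup.mk_surjective t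
  induction t using TensorProduct.induction_on with
  | zero => exact hz
  | tmul m n => exact ht m n
  | add x y hx hy => exact ha _ _ hx hy

theorem hom_ext {f g : BalTensor R M N →+ Q} (h : ∀ m n, f (tmul R m n) = g (tmul R m n)) :
    f = g := by
  ext t
  induction t using BalTensor.induction_on with
  | hz => simp
  | ht m n => exact h m n
  | ha x y hx hy => simp [hx, hy]

theorem hom_congr {f g : BalTensor R M N →+ Q} (h : ∀ m n, f (tmul R m n) = g (tmul R m n))
    (t : BalTensor R M N) : f t = g t :=
  DFunLike.congr_fun (hom_ext h) t

/-- The universal property: a biadditive balanced map `f` induces `m ⊗ n ↦ f m n`. -/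
def lift (f : M →+ N →+ Q) (hf : ∀ m (r : R) n, f (MulOpposite.op r • m) n = f m (r • n)) :
    BalTensor R M N →+ Q :=
  QuotientAddGroup.lift _ (TensorProduct.liftAddHom f (by intro r m n; simp)) (by
    rw [AddSubgroup.closure_le]
    rintro _ ⟨m, r, n, rfl⟩
    simp [AddMonoidHom.mem_ker, hf])

@[simp]
theorem lift_tmul (f : M →+ N →+ Q)
    (hf : ∀ m (r : R) n, f (MulOpposite.op r • m) n = f m (r • n)) (m : M) (n : N) :
    lift f hf (tmul R m n) = f m n := rfl

/-- A variant of `lift` for an unbundled biadditive balanced map. -/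
def lift' (f : M → N → Q) (h₁ : ∀ m m' n, f (m + m') n = f m n + f m' n)
    (h₂ : ∀ m n n', f m (n + n') = f m n + f m n')
    (h₃ : ∀ m (r : R) n, f (MulOpposite.op r • m) n = f m (r • n)) : BalTensor R M N →+ Q :=
  lift (AddMonoidHom.mk' (fun m => AddMonoidHom.mk' (f m) (h₂ m))
    (by intro m m'; ext n; exact h₁ m m' n)) h₃

@[simp]
theorem lift'_tmul (f : M → N → Q) (h₁ : ∀ m m' n, f (m + m') n = f m n + f m' n)
    (h₂ : ∀ m n n', f m (n + n') = f m n + f m n')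
    (h₃ : ∀ m (r : R) n, f (MulOpposite.op r • m) n = f m (r • n)) (m : M) (n : N) :
    lift' f h₁ h₂ h₃ (tmul R m n) = f m n := rfl

/-- The map `f ⊗ g`. -/
def map (f : M →ₗ[Rᵐᵒᵖ] M') (g : N →ₗ[R] N') : BalTensor R M N →+ BalTensor R M' N' :=
  lift' (fun m n => tmul R (f m) (g n)) (by simp [add_tmul]) (by simp [tmul_add])
    (by simp [smul_tmul])

@[simp]
theorem map_tmul (f : M →ₗ[Rᵐᵒᵖ] M') (g : N →ₗ[R] N') (m : M) (n : N) :
    map f g (tmul R m n) = tmul R (f m) (g n) := rfl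

theorem map_comp_left {M'' : Type*} [AddCommGroup M''] [Module Rᵐᵒᵖ M'']
    (g : M' →ₗ[Rᵐᵒᵖ] M'') (f : M →ₗ[Rᵐᵒᵖ] M') (t : BalTensor R M N) :
    map (g ∘ₗ f) (LinearMap.id : N →ₗ[R] N) t = map g LinearMap.id (map f LinearMap.id t) := by
  induction t using BalTensor.induction_on with
  | hz => simp
  | ht m n => rfl
  | ha x y hx hy => simp only [map_add, hx, hy]

section LeftModule

variable {T : Type*} [Ring T] [Module T M] [SMulCommClass T Rᵐᵒᵖ M]

/-- If `M` is a `(T, R)`-bimodule, then `M ⊗_R N` is a left `T`-module. -/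
instance (priority := 900) instModuleLeft : Module T (BalTensor R M N) :=
  letI : SMul T (BalTensor R M N) :=
    ⟨fun t => lift' (fun m n => tmul R (t • m) n) (by simp [add_tmul]) (by simp [tmul_add])
      (fun m r n => by simp only [smul_comm t, smul_tmul])⟩
  have key : ∀ (t : T) (m : M) (n : N), t • tmul R m n = tmul R (t • m) n := fun _ _ _ => rfl
  have hadd : ∀ (t : T) (x y : BalTensor R M N), t • (x + y) = t • x + t • y :=
    fun _ _ _ => map_add (lift' _ _ _ _) _ _
  have hzero : ∀ (t : T), t • (0 : BalTensor R M N) = 0 := fun _ => map_zero (lift' _ _ _ _)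
  Module.ofMinimalAxioms hadd
    (fun s t x => by
      induction x using BalTensor.induction_on with
      | hz => simp [hzero]
      | ht m n => simp only [key, add_smul, add_tmul]
      | ha x y hx hy => rw [hadd, hadd, hadd, hx, hy]; abel)
    (fun s t x => by
      induction x using BalTensor.induction_on with
      | hz => simp [hzero]
      | ht m n => simp only [key, mul_smul]
      | ha x y hx hy => rw [hadd, hadd, hadd, hx, hy])
    (fun x => by
      induction x using BalTensor.induction_on with
      | hz => simp [hzero]
      | ht m n => simp only [key, one_smul]
      | ha x y hx hy => rw [hadd, hx, hy])

theorem smul_tmul_left (t : T) (m : M) (n : N) : t • tmul R m n = tmul R (t • m) n := rfl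

end LeftModule

section RightModule

variable {T : Type*} [Ring T] [Module Tᵐᵒᵖ N] [SMulCommClass R Tᵐᵒᵖ N]

/-- If `N` is an `(R, T)`-bimodule, then `M ⊗_R N` is a right `T`-module. -/
instance instModuleRight : Module Tᵐᵒᵖ (BalTensor R M N) :=
  letI : SMul Tᵐᵒᵖ (BalTensor R M N) :=
    ⟨fun t => lift' (fun m n => tmul R m (t • n)) (by simp [add_tmul]) (by simp [tmul_add])
      (fun m r n => by simp only [← smul_comm r, smul_tmul])⟩
  have key : ∀ (t : Tᵐᵒᵖ) (m : M) (n : N), t • tmul R m n = tmul R m (t • n) := fun _ _ _ => rfl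
  have hadd : ∀ (t : Tᵐᵒᵖ) (x y : BalTensor R M N), t • (x + y) = t • x + t • y :=
    fun _ _ _ => map_add (lift' _ _ _ _) _ _
  have hzero : ∀ (t : Tᵐᵒᵖ), t • (0 : BalTensor R M N) = 0 := fun _ => map_zero (lift' _ _ _ _)
  Module.ofMinimalAxioms hadd
    (fun s t x => by
      induction x using BalTensor.induction_on with
      | hz => simp [hzero]
      | ht m n => simp only [key, add_smul, tmul_add]
      | ha x y hx hy => rw [hadd, hadd, hadd, hx, hy]; abel)
    (fun s t x => by
      induction x using BalTensor.induction_on with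
      | hz => simp [hzero]
      | ht m n => simp only [key, mul_smul]
      | ha x y hx hy => rw [hadd, hadd, hadd, hx, hy])
    (fun x => by
      induction x using BalTensor.induction_on with
      | hz => simp [hzero]
      | ht m n => simp only [key, one_smul]
      | ha x y hx hy => rw [hadd, hx, hy])

theorem smul_tmul_right (t : Tᵐᵒᵖ) (m : M) (n : N) : t • tmul R m n = tmul R m (t • n) := rfl

variable (R) in
/-- The right linear map `n ↦ m ⊗ n`. -/
def tmulLeft (m : M) : N →ₗ[Tᵐᵒᵖ] BalTensor R M N where
  toFun := tmul R m
  map_add' := tmul_add R m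
  map_smul' _ _ := rfl

/-- The map `f ⊗ I_N` as a right linear map. -/
def mapRight (f : M →ₗ[Rᵐᵒᵖ] M') : BalTensor R M N →ₗ[Tᵐᵒᵖ] BalTensor R M' N where
  toFun := map f LinearMap.id
  map_add' := map_add _
  map_smul' t x := by
    induction x using BalTensor.induction_on with
    | hz => simp
    | ht m n => rfl
    | ha x y hx hy => simp only [smul_add, map_add, hx, hy]

end RightModule

/-- The canonical map `R ⊗_R N → N`, `r ⊗ n ↦ r n`. -/
def lid : BalTensor R R N →+ N :=
  lift' (fun r n => r • n) (by simp [add_smul]) (by simp) (by simp [mul_smul])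

@[simp] theorem lid_tmul (r : R) (n : N) : lid (tmul R r n) = r • n := rfl

/-- The canonical map `M ⊗_R R → M`, `m ⊗ r ↦ m r`. -/
def rid : BalTensor R M R →+ M :=
  lift' (fun m r => MulOpposite.op r • m) (by simp) (by simp [add_smul]) (by simp [mul_smul])

@[simp] theorem rid_tmul (m : M) (r : R) : rid (tmul R m r) = MulOpposite.op r • m := rfl

section Assoc

variable (R) (A : Type*) [Ring A]
variable (M N)
variable [Module Aᵐᵒᵖ N] [SMulCommClass R Aᵐᵒᵖ N]
variable (L : Type*) [AddCommGroup L] [Module A L]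

/-- The map `M ⊗_R (N ⊗_A L) → (M ⊗_R N) ⊗_A L`, `m ⊗ (n ⊗ l) ↦ (m ⊗ n) ⊗ l`. -/
def assocHom : BalTensor R M (BalTensor A N L) →+ BalTensor A (BalTensor R M N) L :=
  lift' (fun m t => lift' (R := A) (fun n l => tmul A (tmul R m n) l)
      (by simp [tmul_add, add_tmul]) (by simp [tmul_add])
      (by intro n a l; rw [← smul_tmul, smul_tmul_right]) t)
    (by
      intro m m' t
      rw [← AddMonoidHom.add_apply]
      exact hom_congr (by intro n l; simp [add_tmul]) t)
    (by simp)
    (by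
      intro m r t
      change _ = (lift' _ _ _ _ : _ →+ _) (r • t)
      induction t using BalTensor.induction_on with
      | hz => simp
      | ht n l => simp [smul_tmul_left, smul_tmul]
      | ha x y hx hy => rw [map_add, smul_add, map_add, hx, hy])

/-- The map `(M ⊗_R N) ⊗_A L → M ⊗_R (N ⊗_A L)`, `(m ⊗ n) ⊗ l ↦ m ⊗ (n ⊗ l)`. -/
def assocInv : BalTensor A (BalTensor R M N) L →+ BalTensor R M (BalTensor A N L) :=
  lift' (fun t l => lift' (R := R) (fun m n => tmul R m (tmul A n l))
      (by simp [add_tmul]) (by simp [tmul_add, add_tmul])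
      (by intro m r n; rw [smul_tmul, smul_tmul_left]) t)
    (by simp)
    (by
      intro t l l'
      rw [← AddMonoidHom.add_apply]
      exact hom_congr (by intro n l; simp [tmul_add]) t)
    (by
      intro t a l
      change (lift' _ _ _ _ : _ →+ _) (MulOpposite.op a • t) = _
      induction t using BalTensor.induction_on with
      | hz => simp
      | ht n l => simp [smul_tmul_right, smul_tmul]
      | ha x y hx hy => rw [map_add, smul_add, map_add, hx, hy])

/-- The associativity isomorphism `M ⊗_R (N ⊗_A L) ≅ (M ⊗_R N) ⊗_A L`. -/
def assoc : BalTensor R M (BalTensor A N L) ≃+ BalTensor A (BalTensor R M N) L where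
  toFun := assocHom R M N A L
  invFun := assocInv R M N A L
  left_inv t := by
    refine hom_congr (f := (assocInv R M N A L).comp (assocHom R M N A L))
      (g := AddMonoidHom.id _) (fun m t => ?_) t
    induction t using BalTensor.induction_on with
    | hz => simp [tmul_zero]
    | ht n l => rfl
    | ha x y hx hy => rw [tmul_add, map_add, hx, hy, map_add]
  right_inv t := by
    refine hom_congr (f := (assocHom R M N A L).comp (assocInv R M N A L))
      (g := AddMonoidHom.id _) (fun t l => ?_) t
    induction t using BalTensor.induction_on with
    | hz => simp [zero_tmul]
    | ht n l => rfl
    | ha x y hx hy => rw [add_tmul, map_add, hx, hy, map_add]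
  map_add' := map_add _

variable {M N L}

@[simp]
theorem assoc_tmul (m : M) (n : N) (l : L) :
    assoc R M N A L (tmul R m (tmul A n l)) = tmul A (tmul R m n) l := rfl

@[simp]
theorem assoc_symm_tmul (m : M) (n : N) (l : L) :
    (assoc R M N A L).symm (tmul A (tmul R m n) l) = tmul R m (tmul A n l) := rfl

end Assoc

end BalTensor

end BalTensor

/-! ## Corings -/

/-- `(A, A)`-bilinear maps. -/
structure BimodHom (A M N : Type*) [Ring A] [AddCommGroup M] [Module A M] [Module Aᵐᵒᵖ M]
    [AddCommGroup N] [Module A N] [Module Aᵐᵒᵖ N] extends M →ₗ[A] N where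
  map_op_smul' : ∀ (a : Aᵐᵒᵖ) (m : M), toFun (a • m) = a • toFun m

namespace BimodHom

variable {A M N : Type*} [Ring A] [AddCommGroup M] [Module A M] [Module Aᵐᵒᵖ M]
    [AddCommGroup N] [Module A N] [Module Aᵐᵒᵖ N]

/-- The underlying left linear map. -/
abbrev left (f : BimodHom A M N) : M →ₗ[A] N := f.toLinearMap

/-- The underlying right linear map. -/
def right (f : BimodHom A M N) : M →ₗ[Aᵐᵒᵖ] N where
  toFun := f.left
  map_add' := map_add f.left
  map_smul' := f.map_op_smul'

@[simp] theorem right_apply (f : BimodHom A M N) (m : M) : f.right m = f.left m := rfl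

end BimodHom

/-- An `A`-coring structure on an `(A, A)`-bimodule `C`. -/
class Coring (A C : Type*) [Ring A] [AddCommGroup C] [Module A C] [Module Aᵐᵒᵖ C]
    [SMulCommClass A Aᵐᵒᵖ C] where
  /-- The coproduct. -/
  comul : BimodHom A C (BalTensor A C C)
  /-- The counit. -/
  counit : BimodHom A C A
  coassoc : ∀ c, BalTensor.assoc A C C A C (BalTensor.map LinearMap.id comul.left (comul.left c))
    = BalTensor.map comul.right LinearMap.id (comul.left c)
  counit_comul : ∀ c, BalTensor.lid (BalTensor.map counit.right LinearMap.id (comul.left c)) = c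
  comul_counit : ∀ c, BalTensor.rid (BalTensor.map LinearMap.id counit.left (comul.left c)) = c

section Comodules

variable (A C : Type u) [Ring A] [AddCommGroup C] [Module A C] [Module Aᵐᵒᵖ C]
  [SMulCommClass A Aᵐᵒᵖ C] [Coring A C]

/-- A coring is coseparable if its coproduct is split by a bilinear map `C ⊗_A C → C` that is left
and right colinear. -/
def IsCoseparable : Prop :=
  ∃ π : BimodHom A (BalTensor A C C) C,
    (∀ c : C, π.left ((Coring.comul (A := A) (C := C)).left c) = c) ∧
    (∀ t, (Coring.comul (A := A) (C := C)).left (π.left t) =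
      BalTensor.map LinearMap.id π.left ((BalTensor.assoc A C C A C).symm
        (BalTensor.map (Coring.comul (A := A) (C := C)).right LinearMap.id t))) ∧
    (∀ t, (Coring.comul (A := A) (C := C)).left (π.left t) =
      BalTensor.map π.right LinearMap.id (BalTensor.assoc A C C A C
        (BalTensor.map LinearMap.id (Coring.comul (A := A) (C := C)).left t)))

/-! ## Right and left comodules -/

/-- Right comodules over the `A`-coring `C`. -/
structure RComod where
  /-- The underlying right `A`-module. -/
  carrier : Type u
  [addCommGroup : AddCommGroup carrier]
  [module : Module Aᵐᵒᵖ carrier]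
  /-- The coaction. -/
  coact : carrier →ₗ[Aᵐᵒᵖ] BalTensor A carrier C
  coassoc : ∀ m, BalTensor.assoc A carrier C A C
      (BalTensor.map LinearMap.id Coring.comul.left (coact m))
    = BalTensor.map coact LinearMap.id (coact m)
  counit : ∀ m, BalTensor.rid (BalTensor.map LinearMap.id Coring.counit.left (coact m)) = m

/-- Left comodules over the `A`-coring `C`. -/
structure LComod where
  /-- The underlying left `A`-module. -/
  carrier : Type u
  [addCommGroup : AddCommGroup carrier]
  [module : Module A carrier]
  /-- The coaction. -/
  coact : carrier →ₗ[A] BalTensor A C carrier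
  coassoc : ∀ m, BalTensor.assoc A C C A carrier (BalTensor.map LinearMap.id coact (coact m))
    = BalTensor.map Coring.comul.right LinearMap.id (coact m)
  counit : ∀ m, BalTensor.lid (BalTensor.map Coring.counit.right LinearMap.id (coact m)) = m

attribute [instance] RComod.addCommGroup RComod.module LComod.addCommGroup LComod.module

variable {A C}

namespace RComod

/-- An `A`-linear map between right comodules is colinear if it commutes with the coactions. -/
def IsColinear {M N : RComod A C} (f : M.carrier →ₗ[Aᵐᵒᵖ] N.carrier) : Prop :=
  ∀ m, N.coact (f m) = BalTensor.map f LinearMap.id (M.coact m)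

theorem isColinear_id (M : RComod A C) : IsColinear (M := M) (N := M) LinearMap.id := by
  intro m
  exact (BalTensor.hom_congr (f := BalTensor.map LinearMap.id LinearMap.id)
    (g := AddMonoidHom.id _) (fun _ _ => rfl) (M.coact m)).symm

theorem isColinear_comp {L M N : RComod A C} {g : M.carrier →ₗ[Aᵐᵒᵖ] N.carrier}
    {f : L.carrier →ₗ[Aᵐᵒᵖ] M.carrier} (hg : IsColinear g) (hf : IsColinear f) :
    IsColinear (g ∘ₗ f) := by
  intro m
  rw [LinearMap.comp_apply, hg, hf, BalTensor.map_comp_left]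

theorem isColinear_zero (M N : RComod A C) :
    IsColinear (0 : M.carrier →ₗ[Aᵐᵒᵖ] N.carrier) := by
  intro m
  have := BalTensor.hom_congr (f := BalTensor.map (0 : M.carrier →ₗ[Aᵐᵒᵖ] N.carrier)
    (LinearMap.id : C →ₗ[A] C)) (g := (0 : _ →+ BalTensor A N.carrier C))
    (fun m c => by simp [BalTensor.zero_tmul]) (M.coact m)
  simp [this]

theorem isColinear_add {M N : RComod A C} {f g : M.carrier →ₗ[Aᵐᵒᵖ] N.carrier}
    (hf : IsColinear f) (hg : IsColinear g) : IsColinear (f + g) := by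
  intro m
  rw [LinearMap.add_apply, map_add, hf, hg, ← AddMonoidHom.add_apply]
  exact BalTensor.hom_congr (fun m c => by simp [BalTensor.add_tmul]) _

theorem isColinear_neg {M N : RComod A C} {f : M.carrier →ₗ[Aᵐᵒᵖ] N.carrier}
    (hf : IsColinear f) : IsColinear (-f) := by
  intro m
  have h := BalTensor.hom_congr (f := BalTensor.map f LinearMap.id
      + BalTensor.map (-f) (LinearMap.id : C →ₗ[A] C))
    (g := (0 : _ →+ BalTensor A N.carrier C))
    (fun m c => by simp [← BalTensor.add_tmul, BalTensor.zero_tmul]) (M.coact m)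
  rw [AddMonoidHom.add_apply, ← hf] at h
  rw [LinearMap.neg_apply, map_neg]
  exact (eq_neg_of_add_eq_zero_right h).symm

/-- Morphisms of right comodules: the colinear maps. -/
@[ext]
structure Hom (M N : RComod A C) where
  /-- The underlying right `A`-linear map. -/
  toLinearMap : M.carrier →ₗ[Aᵐᵒᵖ] N.carrier
  colinear : IsColinear toLinearMap

/-- The category of right comodules. -/
instance : Category (RComod A C) where
  Hom := Hom
  id M := ⟨LinearMap.id, isColinear_id M⟩
  comp f g := ⟨g.toLinearMap ∘ₗ f.toLinearMap, isColinear_comp g.colinear f.colinear⟩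

/-- The ring `S = End^C(P)` of colinear endomorphisms; its product is composition, so that `P` is
an `(S, A)`-bimodule by evaluation. -/
def endRing (P : RComod A C) : Subring (Module.End Aᵐᵒᵖ P.carrier) where
  carrier := {f | IsColinear (M := P) (N := P) f}
  mul_mem' := isColinear_comp
  one_mem' := isColinear_id P
  add_mem' := isColinear_add
  zero_mem' := isColinear_zero P P
  neg_mem' := isColinear_neg

theorem endRing_coact (P : RComod A C) (s : endRing P) (p : P.carrier) :
    P.coact (s • p) = s • P.coact p := s.2 p

/-- `Hom_A(P, K)` is a right `S`-module by composition of maps. -/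
instance (P : RComod A C) (K : Type u) [AddCommGroup K] [Module Aᵐᵒᵖ K] :
    Module (endRing P)ᵐᵒᵖ (P.carrier →ₗ[Aᵐᵒᵖ] K) where
  smul s f := f ∘ₗ (s.unop : Module.End Aᵐᵒᵖ P.carrier)
  one_smul _ := rfl
  mul_smul _ _ _ := rfl
  smul_zero _ := LinearMap.zero_comp _
  smul_add _ _ _ := LinearMap.add_comp _ _ _
  add_smul _ _ f := LinearMap.comp_add _ _ f
  zero_smul f := LinearMap.comp_zero f

theorem op_smul_apply (P : RComod A C) (K : Type u) [AddCommGroup K] [Module Aᵐᵒᵖ K]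
    (s : endRing P) (f : P.carrier →ₗ[Aᵐᵒᵖ] K) (p : P.carrier) :
    (MulOpposite.op s • f) p = f (s • p) := rfl

/-- `Hom^C(P, N)`, a right `S`-submodule of `Hom_A(P, N)`. -/
def colinearHom (P N : RComod A C) : Submodule (endRing P)ᵐᵒᵖ (P.carrier →ₗ[Aᵐᵒᵖ] N.carrier) where
  carrier := {f | IsColinear (M := P) (N := N) f}
  add_mem' := isColinear_add
  zero_mem' := isColinear_zero P N
  smul_mem' s _ hf := isColinear_comp hf s.unop.2

variable (A C) in
/-- `C` as a right comodule over itself. -/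
def regular : RComod A C where
  carrier := C
  coact := Coring.comul.right
  coassoc := Coring.coassoc
  counit := Coring.comul_counit

/-- The coaction `x ⊗ m ↦ (x ⊗ m₀) ⊗ m₁` on `X ⊗_R M`, for a right comodule `M` with a left action
of a ring `R` by colinear maps and a right `R`-module `X`. -/
def tensorCoact (R : Type u) [Ring R] (X : Type u) [AddCommGroup X] [Module Rᵐᵒᵖ X]
    (M : RComod A C) [Module R M.carrier] [SMulCommClass R Aᵐᵒᵖ M.carrier]
    (h : ∀ (r : R) (m : M.carrier), M.coact (r • m) = r • M.coact m) :
    BalTensor R X M.carrier →ₗ[Aᵐᵒᵖ] BalTensor A (BalTensor R X M.carrier) C where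
  toFun := fun t => BalTensor.assoc R X M.carrier A C
    (BalTensor.map LinearMap.id ⟨M.coact.toAddHom, h⟩ t)
  map_add' := by simp
  map_smul' := by
    intro a t
    induction t using BalTensor.induction_on with
    | hz => simp
    | ht x m =>
      simp only [BalTensor.smul_tmul_right, BalTensor.map_tmul, LinearMap.id_apply,
        LinearMap.coe_mk, RingHom.id_apply]
      change BalTensor.assoc R X M.carrier A C (BalTensor.tmul R x (M.coact (a • m))) =
        a • BalTensor.assoc R X M.carrier A C (BalTensor.tmul R x (M.coact m))
      rw [map_smul]
      induction M.coact m using BalTensor.induction_on with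
      | hz => simp [BalTensor.tmul_zero]
      | ht m c => rfl
      | ha y z hy hz => simp only [smul_add, BalTensor.tmul_add, map_add, hy, hz]
    | ha y z hy hz => rw [smul_add, map_add, map_add, hy, hz, map_add, map_add, smul_add]

theorem tensorCoact_tmul (R : Type u) [Ring R] (X : Type u) [AddCommGroup X] [Module Rᵐᵒᵖ X]
    (M : RComod A C) [Module R M.carrier] [SMulCommClass R Aᵐᵒᵖ M.carrier]
    (h : ∀ (r : R) (m : M.carrier), M.coact (r • m) = r • M.coact m) (x : X) (m : M.carrier) :
    tensorCoact R X M h (BalTensor.tmul R x m) =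
      BalTensor.map (BalTensor.tmulLeft R x) LinearMap.id (M.coact m) := by
  change BalTensor.assoc R X M.carrier A C (BalTensor.tmul R x (M.coact m)) = _
  induction M.coact m using BalTensor.induction_on with
  | hz => simp [BalTensor.tmul_zero]
  | ht m c => rfl
  | ha y z hy hz => simp only [BalTensor.tmul_add, map_add, hy, hz]

/-- If `M` is a right comodule with a left action of a ring `R` by colinear maps and `X` is a right
`R`-module, then `X ⊗_R M` is a right comodule with the coaction
`x ⊗ m ↦ (x ⊗ m₀) ⊗ m₁`. -/
def tensor (R : Type u) [Ring R] (X : Type u) [AddCommGroup X] [Module Rᵐᵒᵖ X] (M : RComod A C)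
    [Module R M.carrier] [SMulCommClass R Aᵐᵒᵖ M.carrier]
    (h : ∀ (r : R) (m : M.carrier), M.coact (r • m) = r • M.coact m) : RComod A C where
  carrier := BalTensor R X M.carrier
  coact := tensorCoact R X M h
  coassoc t := by
    induction t using BalTensor.induction_on with
    | hz => simp
    | ht x m =>
      rw [tensorCoact_tmul]
      have e₁ : ∀ t, BalTensor.assoc A (BalTensor R X M.carrier) C A C
          (BalTensor.map LinearMap.id (Coring.comul (A := A) (C := C)).left
            (BalTensor.map (BalTensor.tmulLeft R x) LinearMap.id t)) =
          BalTensor.map (BalTensor.mapRight (BalTensor.tmulLeft R x)) LinearMap.id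
            (BalTensor.assoc A M.carrier C A C
              (BalTensor.map LinearMap.id (Coring.comul (A := A) (C := C)).left t)) := by
        intro t
        induction t using BalTensor.induction_on with
        | hz => simp
        | ht m c =>
          simp only [BalTensor.map_tmul, LinearMap.id_apply]
          induction (Coring.comul (A := A) (C := C)).left c using BalTensor.induction_on with
          | hz => simp [BalTensor.tmul_zero]
          | ht c d => rfl
          | ha y z hy hz => simp only [BalTensor.tmul_add, map_add, hy, hz]
        | ha y z hy hz => simp only [map_add, hy, hz]
      rw [e₁, M.coassoc]
      generalize M.coact m = t
      induction t using BalTensor.induction_on with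
      | hz => simp
      | ht m c =>
        simp only [BalTensor.map_tmul, LinearMap.id_apply]
        exact congrArg (fun y => BalTensor.tmul A y c) (tensorCoact_tmul R X M h x m).symm
      | ha y z hy hz => simp only [map_add, hy, hz]
    | ha y z hy hz => simp only [map_add, hy, hz]
  counit t := by
    induction t using BalTensor.induction_on with
    | hz => simp
    | ht x m =>
      rw [tensorCoact_tmul]
      conv_rhs => rw [← M.counit m]
      induction M.coact m using BalTensor.induction_on with
      | hz => simp [BalTensor.tmul_zero]
      | ht m c => rfl
      | ha y z hy hz => simp only [BalTensor.tmul_add, map_add, hy, hz]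
    | ha y z hy hz => simp only [map_add, hy, hz]

/-- The right comodule `K ⊗_A C` with coaction `I_K ⊗ Δ`, for a right `A`-module `K`. -/
def cofree (K : Type u) [AddCommGroup K] [Module Aᵐᵒᵖ K] : RComod A C :=
  letI : Module A (regular A C).carrier := inferInstanceAs (Module A C)
  letI : SMulCommClass A Aᵐᵒᵖ (regular A C).carrier := inferInstanceAs (SMulCommClass A Aᵐᵒᵖ C)
  tensor A K (regular A C) (fun a c => map_smul (Coring.comul (A := A) (C := C)).left a c)

/-- The right comodule `X ⊗_S P`, for a right `S`-module `X`. -/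
def tensorEnd (P : RComod A C) (X : Type u) [AddCommGroup X] [Module (endRing P)ᵐᵒᵖ X] :
    RComod A C :=
  tensor (endRing P) X P (endRing_coact P)

/-! ## Strong relative injectivity, Galois comodules -/

/-- `P` is strongly `(C, A)`-injective if its coaction `P → P ⊗_A C` is split by a map that is
colinear and left linear over `S = End^C(P)`. -/
def IsStronglyRelInjective (P : RComod A C) : Prop :=
  ∃ l : BalTensor A P.carrier C →ₗ[Aᵐᵒᵖ] P.carrier,
    IsColinear (M := cofree P.carrier) (N := P) l ∧ (∀ p, l (P.coact p) = p) ∧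
    ∀ (s : endRing P) (t : BalTensor A P.carrier C), l (s • t) = s • l t

/-- The canonical map `Hom_A(P, K) ⊗_S P → K ⊗_A C`, `g ⊗ p ↦ (g ⊗ I_C)(ρ(p))`. -/
def galoisMap (P : RComod A C) (K : Type u) [AddCommGroup K] [Module Aᵐᵒᵖ K] :
    BalTensor (endRing P) (P.carrier →ₗ[Aᵐᵒᵖ] K) P.carrier →+ BalTensor A K C :=
  BalTensor.lift' (fun g p => BalTensor.map g LinearMap.id (P.coact p))
    (by
      intro g g' p
      rw [← AddMonoidHom.add_apply]
      exact BalTensor.hom_congr (fun m c => by simp [BalTensor.add_tmul]) _)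
    (by simp)
    (by
      intro g s p
      rw [show P.coact (s • p) = BalTensor.map (s : Module.End Aᵐᵒᵖ P.carrier) LinearMap.id
        (P.coact p) from s.2 p, ← BalTensor.map_comp_left]
      rfl)

/-- `P` is a Galois comodule if `Hom_A(P, K) ⊗_S P → K ⊗_A C` is an isomorphism for every right
`A`-module `K`. -/
def IsGalois (P : RComod A C) : Prop :=
  ∀ (K : Type u) [AddCommGroup K] [Module Aᵐᵒᵖ K], Function.Bijective (galoisMap P K)

/-! ## The functors `Hom^C(P, -)` and `- ⊗_S P` -/

/-- The functor `Hom^C(P, -)` from right comodules to right `S`-modules. -/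
def homFunctor (P : RComod A C) : RComod A C ⥤ ModuleCat.{u} (endRing P)ᵐᵒᵖ where
  obj N := ModuleCat.of (endRing P)ᵐᵒᵖ (colinearHom P N)
  map f := ModuleCat.ofHom
    { toFun := fun g => ⟨f.toLinearMap ∘ₗ g.1, isColinear_comp f.colinear g.2⟩
      map_add' := fun _ _ => Subtype.ext (LinearMap.comp_add _ _ _)
      map_smul' := fun _ _ => rfl }

theorem tensorCoact_natural (P : RComod A C) {X Y : Type u} [AddCommGroup X]
    [Module (endRing P)ᵐᵒᵖ X] [AddCommGroup Y] [Module (endRing P)ᵐᵒᵖ Y]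
    (f : X →ₗ[(endRing P)ᵐᵒᵖ] Y) :
    IsColinear (M := tensorEnd P X) (N := tensorEnd P Y)
      (BalTensor.mapRight (N := P.carrier) f) := by
  intro t
  change tensorCoact (endRing P) Y P (endRing_coact P) (BalTensor.map f LinearMap.id t) =
    BalTensor.map (BalTensor.mapRight (N := P.carrier) f) LinearMap.id
      (tensorCoact (endRing P) X P (endRing_coact P) t)
  induction t using BalTensor.induction_on with
  | hz => simp
  | ht x p =>
    rw [BalTensor.map_tmul, tensorCoact_tmul, tensorCoact_tmul, ← BalTensor.map_comp_left]
    rfl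
  | ha y z hy hz => simp only [map_add, hy, hz]

/-- The functor `- ⊗_S P` from right `S`-modules to right comodules. -/
def tensorFunctor (P : RComod A C) : ModuleCat.{u} (endRing P)ᵐᵒᵖ ⥤ RComod A C where
  obj X := tensorEnd P X
  map f := ⟨BalTensor.mapRight (N := P.carrier) f.hom, tensorCoact_natural P f.hom⟩
  map_id X := Hom.ext (LinearMap.ext fun t => by
    exact BalTensor.hom_congr (f := BalTensor.map (𝟙 X : X ⟶ X).hom LinearMap.id)
      (g := AddMonoidHom.id _) (fun _ _ => rfl) t)
  map_comp f g := Hom.ext (LinearMap.ext fun t => by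
    exact BalTensor.map_comp_left g.hom f.hom t)

end RComod

/-! ## Left comodules: relative injectivity, cotensor product, coflatness -/

/-- A left comodule `L` is `(C, A)`-injective if its coaction `L → C ⊗_A L` is split by a left
colinear map, where `C ⊗_A L` has the coaction `Δ ⊗ I_L`. -/
def LComod.IsRelInjective (L : LComod A C) : Prop :=
  ∃ l : BalTensor A C L.carrier →ₗ[A] L.carrier,
    (∀ t, L.coact (l t) = BalTensor.map LinearMap.id l
      ((BalTensor.assoc A C C A L.carrier).symm
        (BalTensor.map (Coring.comul (A := A) (C := C)).right LinearMap.id t))) ∧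
    ∀ x, l (L.coact x) = x

/-- The cotensor product of `N` and `L`: the kernel of `ρ_N ⊗ I_L - I_N ⊗ ρ_L` on `N ⊗_A L`. -/
def cotensor (N : RComod A C) (L : LComod A C) :
    AddSubgroup (BalTensor A N.carrier L.carrier) :=
  (BalTensor.map N.coact LinearMap.id).eqLocus
    ((BalTensor.assoc A N.carrier C A L.carrier).toAddMonoidHom.comp
      (BalTensor.map LinearMap.id L.coact))

/-- The map between cotensor products induced by a colinear map. -/
def cotensorMap {M N : RComod A C} (f : M ⟶ N) (L : LComod A C) :
    cotensor M L →+ cotensor N L :=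
  ((BalTensor.map f.toLinearMap LinearMap.id).comp (cotensor M L).subtype).codRestrict
    (cotensor N L) (by
      rintro ⟨t, ht⟩
      have ht' : BalTensor.map M.coact LinearMap.id t =
        BalTensor.assoc A M.carrier C A L.carrier (BalTensor.map LinearMap.id L.coact t) := ht
      change BalTensor.map N.coact LinearMap.id (BalTensor.map f.toLinearMap LinearMap.id t) =
        BalTensor.assoc A N.carrier C A L.carrier (BalTensor.map LinearMap.id L.coact
          (BalTensor.map f.toLinearMap LinearMap.id t))
      have e₁ : ∀ t, BalTensor.map N.coact (LinearMap.id : L.carrier →ₗ[A] L.carrier)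
          (BalTensor.map f.toLinearMap LinearMap.id t) =
          BalTensor.map (BalTensor.mapRight f.toLinearMap) LinearMap.id
            (BalTensor.map M.coact LinearMap.id t) := by
        intro t
        induction t using BalTensor.induction_on with
        | hz => simp
        | ht m x =>
          exact congrArg (fun y => BalTensor.tmul A y x) (f.colinear m)
        | ha y z hy hz => simp only [map_add, hy, hz]
      have e₂ : ∀ t, BalTensor.assoc A N.carrier C A L.carrier (BalTensor.map LinearMap.id L.coact
          (BalTensor.map f.toLinearMap LinearMap.id t)) =
          BalTensor.map (BalTensor.mapRight f.toLinearMap) LinearMap.id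
            (BalTensor.assoc A M.carrier C A L.carrier
              (BalTensor.map LinearMap.id L.coact t)) := by
        intro t
        induction t using BalTensor.induction_on with
        | hz => simp
        | ht m x =>
          simp only [BalTensor.map_tmul, LinearMap.id_apply]
          induction L.coact x using BalTensor.induction_on with
          | hz => simp [BalTensor.tmul_zero]
          | ht c d => rfl
          | ha y z hy hz => simp only [BalTensor.tmul_add, map_add, hy, hz]
        | ha y z hy hz => simp only [map_add, hy, hz]
      rw [e₁, e₂, ht'])

/-- A left comodule `L` is coflat if cotensoring with `L` maps short exact sequences of right
comodules to short exact sequences of abelian groups. -/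
def LComod.IsCoflat (L : LComod A C) : Prop :=
  ∀ (K M N : RComod A C) (f : K ⟶ M) (g : M ⟶ N),
    Function.Injective f.toLinearMap → Function.Exact f.toLinearMap g.toLinearMap →
    Function.Surjective g.toLinearMap →
    Function.Injective (cotensorMap f L) ∧ Function.Exact (cotensorMap f L) (cotensorMap g L) ∧
    Function.Surjective (cotensorMap g L)

end Comodules

/-- Flatness of a left module `M` over a not necessarily commutative ring `R`: the functor
`- ⊗_R M` preserves injective maps. -/
def IsFlatLeft (R M : Type u) [Ring R] [AddCommGroup M] [Module R M] : Prop :=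
  ∀ (X Y : Type u) [AddCommGroup X] [Module Rᵐᵒᵖ X] [AddCommGroup Y] [Module Rᵐᵒᵖ Y]
    (f : X →ₗ[Rᵐᵒᵖ] Y), Function.Injective f →
    Function.Injective (BalTensor.map f (LinearMap.id : M →ₗ[R] M))

/-! ## The left comodule `P* = Hom_A(P, A)` -/

section Dual

variable {A C : Type u} [Ring A]

section Modules

variable {M Y : Type u} [AddCommGroup M] [Module Aᵐᵒᵖ M] [AddCommGroup Y] [Module Aᵐᵒᵖ Y]

/-- The map `Y ⊗_A M* → Hom_A(M, Y)`, `y ⊗ h ↦ y h(-)`. -/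
def dualEval : BalTensor A Y (M →ₗ[Aᵐᵒᵖ] A) →+ (M →ₗ[Aᵐᵒᵖ] Y) :=
  BalTensor.lift' (fun y h =>
      { toFun := fun m => MulOpposite.op (h m) • y
        map_add' := by intro m m'; rw [map_add, MulOpposite.op_add, add_smul]
        map_smul' := by
          intro a m
          rw [map_smul, RingHom.id_apply, ← mul_smul, ← MulOpposite.op_unop a, op_smul_eq_mul,
            MulOpposite.op_mul] })
    (by intro y y' h; ext m; simp)
    (by intro y h h'; ext m; simp [add_smul])
    (by intro y a h; ext m; simp [mul_smul])

@[simp]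
theorem dualEval_tmul (y : Y) (h : M →ₗ[Aᵐᵒᵖ] A) (m : M) :
    dualEval (BalTensor.tmul A y h) m = MulOpposite.op (h m) • y := rfl

theorem exists_dual_basis (A M : Type u) [Ring A] [AddCommGroup M] [Module Aᵐᵒᵖ M]
    [Module.Finite Aᵐᵒᵖ M] [Module.Projective Aᵐᵒᵖ M] :
    ∃ (n : ℕ) (p : Fin n → M) (π : Fin n → M →ₗ[Aᵐᵒᵖ] A),
      ∀ m, ∑ i, MulOpposite.op (π i m) • p i = m := by
  obtain ⟨n, f, g, -, -, hfg⟩ := Module.Finite.exists_comp_eq_id_of_projective Aᵐᵒᵖ M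
  refine ⟨n, fun i => f (Pi.single i 1), fun i =>
    { toFun := fun m => MulOpposite.unop (g m i)
      map_add' := by simp
      map_smul' := by intro a m; rw [map_smul]; rfl }, ?_⟩
  intro m
  conv_rhs => rw [← LinearMap.id_apply (R := Aᵐᵒᵖ) m, ← hfg, LinearMap.comp_apply,
    ← Finset.univ_sum_single (g m), map_sum]
  refine Finset.sum_congr rfl fun i _ => ?_
  simp [← map_smul, ← Pi.single_smul]

theorem dualEval_bijective [Module.Finite Aᵐᵒᵖ M] [Module.Projective Aᵐᵒᵖ M] :
    Function.Bijective (dualEval : BalTensor A Y (M →ₗ[Aᵐᵒᵖ] A) →+ (M →ₗ[Aᵐᵒᵖ] Y)) := by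
  obtain ⟨n, p, π, hp⟩ := exists_dual_basis A M
  have hπ : ∀ h : M →ₗ[Aᵐᵒᵖ] A, ∑ i, h (p i) • π i = h := by
    intro h
    ext m
    conv_rhs => rw [← hp m, map_sum]
    simp
  have key : ∀ t : BalTensor A Y (M →ₗ[Aᵐᵒᵖ] A),
      ∑ i, BalTensor.tmul A (dualEval t (p i)) (π i) = t := by
    intro t
    induction t using BalTensor.induction_on with
    | hz => simp [BalTensor.zero_tmul]
    | ht y h =>
      simp only [dualEval_tmul, BalTensor.smul_tmul]
      conv_rhs => rw [← hπ h]
      exact (map_sum (AddMonoidHom.mk' (BalTensor.tmul A y) (BalTensor.tmul_add A y)) _ _).symm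
    | ha y z hy hz =>
      conv_rhs => rw [← hy, ← hz]
      simp [BalTensor.add_tmul, Finset.sum_add_distrib]
  refine ⟨fun s t h => by rw [← key s, ← key t, h], fun g => ?_⟩
  refine ⟨∑ i, BalTensor.tmul A (g (p i)) (π i), ?_⟩
  ext m
  conv_rhs => rw [← hp m, map_sum]
  simp

variable [AddCommGroup C] [Module A C] [Module Aᵐᵒᵖ C] [SMulCommClass A Aᵐᵒᵖ C]

/-- The map `g ⊗ I_C : M ⊗_A C → C`, `m ⊗ c ↦ g(m) c`, for `g ∈ M*`. -/
def contract (g : M →ₗ[Aᵐᵒᵖ] A) : BalTensor A M C →ₗ[Aᵐᵒᵖ] C where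
  toFun t := BalTensor.lid (BalTensor.map g LinearMap.id t)
  map_add' := by simp
  map_smul' a t := by
    induction t using BalTensor.induction_on with
    | hz => simp
    | ht m c => exact smul_comm (g m) a c
    | ha y z hy hz => simp only [smul_add, map_add, hy, hz]

@[simp]
theorem contract_tmul (g : M →ₗ[Aᵐᵒᵖ] A) (m : M) (c : C) :
    contract g (BalTensor.tmul A m c) = g m • c := rfl

theorem dualEval_smul (a : A) (t : BalTensor A C (M →ₗ[Aᵐᵒᵖ] A)) (m : M) :
    dualEval (a • t) m = a • dualEval t m := by
  induction t using BalTensor.induction_on with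
  | hz => simp
  | ht c h => exact (smul_comm a (MulOpposite.op (h m)) c).symm
  | ha y z hy hz => simp only [smul_add, map_add, LinearMap.add_apply, hy, hz]

end Modules

variable [AddCommGroup C] [Module A C] [Module Aᵐᵒᵖ C] [SMulCommClass A Aᵐᵒᵖ C] [Coring A C]
variable (P : RComod A C) [Module.Finite Aᵐᵒᵖ P.carrier] [Module.Projective Aᵐᵒᵖ P.carrier]

/-- The coaction on `P*`: the image of `g` is the element of `C ⊗_A P*` that corresponds to
`(g ⊗ I_C) ∘ ρ : P → C` under the isomorphism `C ⊗_A P* ≅ Hom_A(P, C)`. -/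
noncomputable def dualCoactFun (g : P.carrier →ₗ[Aᵐᵒᵖ] A) :
    BalTensor A C (P.carrier →ₗ[Aᵐᵒᵖ] A) :=
  (AddEquiv.ofBijective dualEval dualEval_bijective).symm (contract g ∘ₗ P.coact)

theorem dualEval_dualCoactFun (g : P.carrier →ₗ[Aᵐᵒᵖ] A) :
    dualEval (dualCoactFun P g) = contract g ∘ₗ P.coact :=
  (AddEquiv.ofBijective dualEval dualEval_bijective).apply_symm_apply (contract g ∘ₗ P.coact)

/-- The coaction on `P*` as a left linear map. -/
noncomputable def dualCoact :
    (P.carrier →ₗ[Aᵐᵒᵖ] A) →ₗ[A] BalTensor A C (P.carrier →ₗ[Aᵐᵒᵖ] A) where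
  toFun := dualCoactFun P
  map_add' g h := by
    apply dualEval_bijective.1
    ext p
    rw [map_add]
    simp only [dualEval_dualCoactFun, LinearMap.add_apply, LinearMap.comp_apply]
    induction P.coact p using BalTensor.induction_on with
    | hz => simp
    | ht m c => simp [add_smul]
    | ha y z hy hz => simp only [map_add, hy, hz]; abel
  map_smul' a g := by
    apply dualEval_bijective.1
    ext p
    rw [RingHom.id_apply, dualEval_smul]
    simp only [dualEval_dualCoactFun, LinearMap.comp_apply]
    induction P.coact p using BalTensor.induction_on with
    | hz => simp
    | ht m c => simp [mul_smul]
    | ha y z hy hz => simp only [map_add, hy, hz, smul_add]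

theorem dualEval_dualCoact (g : P.carrier →ₗ[Aᵐᵒᵖ] A) :
    dualEval (dualCoact P g) = contract g ∘ₗ P.coact :=
  dualEval_dualCoactFun P g

/-- The left comodule `P* = Hom_A(P, A)`, for `P` finitely generated and projective over `A`. -/
noncomputable def RComod.dual : LComod A C where
  carrier := P.carrier →ₗ[Aᵐᵒᵖ] A
  coact := dualCoact P
  coassoc g := by
    apply dualEval_bijective.1
    ext p
    have e₁ : ∀ (c : C) (u : BalTensor A C (P.carrier →ₗ[Aᵐᵒᵖ] A)),
        dualEval (BalTensor.assoc A C C A _ (BalTensor.tmul A c u)) p =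
          BalTensor.tmul A c (dualEval u p) := by
      intro c u
      induction u using BalTensor.induction_on with
      | hz => simp [BalTensor.tmul_zero]
      | ht d h => rfl
      | ha y z hy hz => simp only [BalTensor.tmul_add, map_add, LinearMap.add_apply, hy, hz]
    have e₂ : ∀ t : BalTensor A C (P.carrier →ₗ[Aᵐᵒᵖ] A),
        dualEval (BalTensor.assoc A C C A _ (BalTensor.map LinearMap.id (dualCoact P) t)) p =
          BalTensor.map (dualEval t) LinearMap.id (P.coact p) := by
      intro t
      induction t using BalTensor.induction_on with
      | hz =>
        have := BalTensor.hom_congr (f := BalTensor.map (0 : P.carrier →ₗ[Aᵐᵒᵖ] C)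
          (LinearMap.id : C →ₗ[A] C)) (g := (0 : _ →+ BalTensor A C C))
          (fun m c => by simp [BalTensor.zero_tmul]) (P.coact p)
        simp [this]
      | ht c h =>
        rw [BalTensor.map_tmul, e₁, dualEval_dualCoact, LinearMap.comp_apply]
        induction P.coact p using BalTensor.induction_on with
        | hz => simp [BalTensor.tmul_zero]
        | ht m d => exact (BalTensor.smul_tmul A (h m) c d).symm
        | ha y z hy hz => simp only [BalTensor.tmul_add, map_add, hy, hz]
      | ha y z hy hz =>
        have := BalTensor.hom_congr (f := BalTensor.map (dualEval y + dualEval z)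
          (LinearMap.id : C →ₗ[A] C)) (g := BalTensor.map (dualEval y) LinearMap.id
            + BalTensor.map (dualEval z) LinearMap.id)
          (fun m c => by simp [BalTensor.add_tmul]) (P.coact p)
        simp only [map_add, LinearMap.add_apply, hy, hz, this, AddMonoidHom.add_apply]
    have e₃ : ∀ t : BalTensor A C (P.carrier →ₗ[Aᵐᵒᵖ] A),
        dualEval (BalTensor.map (Coring.comul (A := A) (C := C)).right LinearMap.id t) p =
          (Coring.comul (A := A) (C := C)).right (dualEval t p) := by
      intro t
      induction t using BalTensor.induction_on with
      | hz => simp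
      | ht c h =>
        exact (map_smul (Coring.comul (A := A) (C := C)).right (MulOpposite.op (h p)) c).symm
      | ha y z hy hz => simp only [map_add, LinearMap.add_apply, hy, hz]
    have e₄ : ∀ t : BalTensor A P.carrier C,
        BalTensor.map (contract g) LinearMap.id (BalTensor.assoc A P.carrier C A C
          (BalTensor.map LinearMap.id (Coring.comul (A := A) (C := C)).left t)) =
          (Coring.comul (A := A) (C := C)).left (contract g t) := by
      intro t
      induction t using BalTensor.induction_on with
      | hz => simp
      | ht m c =>
        rw [contract_tmul, map_smul, BalTensor.map_tmul, LinearMap.id_apply]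
        induction (Coring.comul (A := A) (C := C)).left c using BalTensor.induction_on with
        | hz => simp [BalTensor.tmul_zero]
        | ht c d => rfl
        | ha y z hy hz => simp only [BalTensor.tmul_add, map_add, smul_add, hy, hz]
      | ha y z hy hz => simp only [map_add, hy, hz]
    rw [e₂, e₃, dualEval_dualCoact, LinearMap.comp_apply, BimodHom.right_apply, ← e₄, P.coassoc,
      BalTensor.map_comp_left]
  counit g := by
    ext p
    have e₁ : ∀ t : BalTensor A C (P.carrier →ₗ[Aᵐᵒᵖ] A),
        BalTensor.lid (BalTensor.map (Coring.counit (A := A) (C := C)).right LinearMap.id t) p =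
          (Coring.counit (A := A) (C := C)).right (dualEval t p) := by
      intro t
      induction t using BalTensor.induction_on with
      | hz => simp
      | ht c h => rw [dualEval_tmul, map_smul]; rfl
      | ha y z hy hz => simp only [map_add, LinearMap.add_apply, hy, hz]
    rw [e₁, dualEval_dualCoact, LinearMap.comp_apply]
    conv_rhs => rw [← P.counit p]
    induction P.coact p using BalTensor.induction_on with
    | hz => simp
    | ht m c => simp
    | ha y z hy hz => simp only [map_add, hy, hz]

end Dual

/-! The functor `- ⊗_S P` is left adjoint to `Hom^C(P, -)`. Its unit is `x ↦ x ⊗ -` (`unitMap`) and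
its counit is evaluation (`counitMap`). The theorem holds once all components of both are bijective
(`exists_equivalence`).

Counit. `Hom^C(P, N)` is the equalizer of the two maps `g ↦ ρ_N ∘ g` and `g ↦ (g ⊗ I) ∘ ρ_P` from
`Hom_A(P, N)` to `Hom_A(P, N ⊗_A C)`. After `- ⊗_S P`, the Galois isomorphisms turn this pair into
`ρ_N ⊗ I` and `I ⊗ Δ` from `N ⊗_A C` to `N ⊗_A C ⊗_A C`, and `N` embedded by `ρ_N` is the equalizer
of these. So the counit is bijective whenever `- ⊗_S P` preserves the first equalizer
(`counitMap_bijective_of_equalizer`). Flatness of `P` over `S` ensures this. So does an `S`-linear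
colinear splitting `l` of `ρ_P`: transported along the Galois isomorphism, it makes the equalizer
split, and split equalizers survive every additive functor.

Unit. With a splitting `l`, the map `f ↦ l ∘ (f ⊗ I) ∘ ρ` is a left `S`-linear retraction of
`End_A(P)` onto `S`; combined with a dual basis of `P` it gives an explicit inverse of the unit
(`unitMap_bijective_of_splitting`). In the flat cases, `N ⊗_A P* ≅ Hom_A(P, N)` identifies the
cotensor product of `N` and `P*` with `Hom^C(P, N)` (`mem_cotensor_dual_iff`), so exactness of
cotensoring makes `Hom^C(P, -)` exact. The unit is bijective on free modules because `P` is finitely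
generated, and a free presentation carries this to every module.

The four cases thus become two. Coseparability yields strong relative injectivity of every comodule
(`isStronglyRelInjective_of_isCoseparable`). Relative injectivity and coflatness of `P*` both give
right exactness of the cotensor product. -/

namespace BalTensor

/-! ### Right exactness of the balanced tensor product -/

section RightExact

variable {R : Type*} [Ring R]
variable {X : Type*} [AddCommGroup X] [Module Rᵐᵒᵖ X]
variable {Y : Type*} [AddCommGroup Y] [Module Rᵐᵒᵖ Y]
variable {Z : Type*} [AddCommGroup Z] [Module Rᵐᵒᵖ Z]
variable {N : Type*} [AddCommGroup N] [Module R N]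

theorem map_id (t : BalTensor R X N) :
    map (LinearMap.id : X →ₗ[Rᵐᵒᵖ] X) (LinearMap.id : N →ₗ[R] N) t = t :=
  hom_congr (f := map _ _) (g := AddMonoidHom.id _) (fun _ _ => rfl) t

theorem map_add_left (f g : X →ₗ[Rᵐᵒᵖ] Y) (t : BalTensor R X N) :
    map (f + g) (LinearMap.id : N →ₗ[R] N) t = map f LinearMap.id t + map g LinearMap.id t :=
  hom_congr (f := map (f + g) LinearMap.id) (g := map f LinearMap.id + map g LinearMap.id)
    (fun m n => by simp [add_tmul]) t

theorem map_zero_left (t : BalTensor R X N) :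
    map (0 : X →ₗ[Rᵐᵒᵖ] Y) (LinearMap.id : N →ₗ[R] N) t = 0 :=
  hom_congr (f := map 0 LinearMap.id) (g := 0) (fun _ n => zero_tmul R n) t

theorem map_sub_left (f g : X →ₗ[Rᵐᵒᵖ] Y) (t : BalTensor R X N) :
    map (f - g) (LinearMap.id : N →ₗ[R] N) t = map f LinearMap.id t - map g LinearMap.id t := by
  rw [eq_sub_iff_add_eq, ← map_add_left, sub_add_cancel]

theorem sum_tmul {ι : Type*} (s : Finset ι) (x : ι → X) (n : N) :
    tmul R (∑ i ∈ s, x i) n = ∑ i ∈ s, tmul R (x i) n :=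
  map_sum (AddMonoidHom.mk' (fun x => tmul R x n) (fun x x' => add_tmul R x x' n)) _ _

theorem map_surjective {f : X →ₗ[Rᵐᵒᵖ] Y} (hf : Function.Surjective f) :
    Function.Surjective (map f (LinearMap.id : N →ₗ[R] N)) := by
  intro t
  induction t using BalTensor.induction_on with
  | hz => exact ⟨0, map_zero _⟩
  | ht y n =>
    obtain ⟨x, rfl⟩ := hf y
    exact ⟨tmul R x n, rfl⟩
  | ha y z hy hz =>
    obtain ⟨a, rfl⟩ := hy
    obtain ⟨b, rfl⟩ := hz
    exact ⟨a + b, map_add _ _ _⟩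

/-- Lifting `z` along `g` gives a well-defined map from `Z ⊗ N` to the cokernel of `f ⊗ N`, because
two lifts differ by an element of the image of `f`. It sends the image of `t` to the class of `t`,
so the kernel of `g ⊗ N` dies in the cokernel. -/
theorem map_exact {f : X →ₗ[Rᵐᵒᵖ] Y} {g : Y →ₗ[Rᵐᵒᵖ] Z} (hfg : Function.Exact f g)
    (hg : Function.Surjective g) :
    Function.Exact (map f (LinearMap.id : N →ₗ[R] N)) (map g (LinearMap.id : N →ₗ[R] N)) := by
  intro t
  constructor
  · intro ht
    let I : AddSubgroup (BalTensor R Y N) := (map f (LinearMap.id : N →ₗ[R] N)).range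
    have key : ∀ (a b : Y) (n : N), g a = g b →
        (QuotientAddGroup.mk (tmul R a n) : BalTensor R Y N ⧸ I) =
          QuotientAddGroup.mk (tmul R b n) := by
      intro a b n hab
      rw [QuotientAddGroup.eq_iff_sub_mem]
      obtain ⟨x, hx⟩ := (hfg (a - b)).1 (by rw [map_sub, hab, sub_self])
      refine ⟨tmul R x n, ?_⟩
      rw [map_tmul, hx, eq_comm, sub_eq_iff_eq_add, LinearMap.id_apply, ← add_tmul,
        sub_add_cancel]
    -- `σ` is only a set-theoretic section; additivity and balancedness of the induced map hold
    -- modulo `I`, by `key`.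
    let σ := Function.surjInv hg
    have hσ : ∀ z, g (σ z) = z := Function.surjInv_eq hg
    let inv : BalTensor R Z N →+ BalTensor R Y N ⧸ I :=
      lift' (fun z n => QuotientAddGroup.mk (tmul R (σ z) n))
        (by
          intro z z' n
          rw [← QuotientAddGroup.mk_add, ← add_tmul]
          exact key _ _ _ (by simp [hσ]))
        (by intro z n n'; rw [tmul_add, QuotientAddGroup.mk_add])
        (by
          intro z r n
          rw [← smul_tmul]
          exact key _ _ _ (by simp [hσ]))
    have hinv : ∀ t, inv (map g LinearMap.id t) = QuotientAddGroup.mk t := by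
      intro t
      exact hom_congr (f := inv.comp (map g LinearMap.id)) (g := QuotientAddGroup.mk' I)
        (fun y n => key _ _ _ (hσ _)) t
    have h0 := hinv t
    rw [ht, map_zero, eq_comm, QuotientAddGroup.eq_zero_iff] at h0
    exact h0
  · rintro ⟨s, rfl⟩
    rw [← map_comp_left, hfg.linearMap_comp_eq_zero, map_zero_left]

end RightExact

theorem hom_congr₂ {A K C L Q : Type*} [Ring A] [AddCommGroup K] [Module Aᵐᵒᵖ K] [AddCommGroup C]
    [Module A C] [Module Aᵐᵒᵖ C] [SMulCommClass A Aᵐᵒᵖ C] [AddCommGroup L] [Module A L]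
    [AddCommGroup Q] {f g : BalTensor A (BalTensor A K C) L →+ Q}
    (h : ∀ (k : K) (d : C) (x : L), f (tmul A (tmul A k d) x) = g (tmul A (tmul A k d) x))
    (t : BalTensor A (BalTensor A K C) L) : f t = g t := by
  refine hom_congr (fun y x => ?_) t
  induction y using BalTensor.induction_on with
  | hz => simp [zero_tmul]
  | ht k d => exact h k d x
  | ha y z hy hz => simp only [map_add, add_tmul, hy, hz]

end BalTensor

/-! ### Unit and counit of the adjunction -/

namespace RComod

variable {A C : Type u} [Ring A] [AddCommGroup C] [Module A C] [Module Aᵐᵒᵖ C]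
  [SMulCommClass A Aᵐᵒᵖ C] [Coring A C]

theorem coact_injective (N : RComod A C) : Function.Injective N.coact := by
  intro m n h
  rw [← N.counit m, h, N.counit]

/-- A bijective colinear map is an isomorphism of comodules. -/
theorem isIso_of_bijective {M N : RComod A C} (f : M ⟶ N)
    (hf : Function.Bijective f.toLinearMap) : IsIso f := by
  let e := LinearEquiv.ofBijective f.toLinearMap hf
  have he : f.toLinearMap ∘ₗ (e.symm : N.carrier →ₗ[Aᵐᵒᵖ] M.carrier) = LinearMap.id :=
    LinearMap.ext fun n => e.apply_symm_apply n
  have he' : (e.symm : N.carrier →ₗ[Aᵐᵒᵖ] M.carrier) ∘ₗ f.toLinearMap = LinearMap.id :=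
    LinearMap.ext fun n => e.symm_apply_apply n
  refine ⟨⟨⟨e.symm, ?_⟩, Hom.ext he', Hom.ext he⟩⟩
  intro n
  obtain ⟨m, rfl⟩ := hf.2 n
  have h1 : (e.symm : N.carrier →ₗ[Aᵐᵒᵖ] M.carrier) (f.toLinearMap m) = m :=
    LinearMap.congr_fun he' m
  rw [h1, f.colinear, ← BalTensor.map_comp_left, he', BalTensor.map_id]

variable (P : RComod A C)

/-- The map `X → Hom^C(P, X ⊗_S P)`, `x ↦ x ⊗ -`. -/
def unitMap (X : Type u) [AddCommGroup X] [Module (endRing P)ᵐᵒᵖ X] :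
    X →ₗ[(endRing P)ᵐᵒᵖ] colinearHom P (tensorEnd P X) where
  toFun x := ⟨BalTensor.tmulLeft (endRing P) x, fun p =>
    tensorCoact_tmul (endRing P) X P (endRing_coact P) x p⟩
  map_add' x y := Subtype.ext (LinearMap.ext fun p => BalTensor.add_tmul _ x y p)
  map_smul' s x := Subtype.ext (LinearMap.ext fun p =>
    BalTensor.smul_tmul (endRing P) s.unop x p)

/-- The evaluation map `Hom_A(P, K) ⊗_S P → K`. -/
def evalHom (K : Type u) [AddCommGroup K] [Module Aᵐᵒᵖ K] :
    BalTensor (endRing P) (P.carrier →ₗ[Aᵐᵒᵖ] K) P.carrier →ₗ[Aᵐᵒᵖ] K where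
  toFun := BalTensor.lift' (fun g p => g p) (fun _ _ _ => rfl) (fun g => map_add g)
    (fun _ _ _ => rfl)
  map_add' := map_add _
  map_smul' a t := by
    induction t using BalTensor.induction_on with
    | hz => simp
    | ht g p => exact map_smul g a p
    | ha x y hx hy => simp only [smul_add, map_add, hx, hy]

/-- The evaluation map `Hom^C(P, N) ⊗_S P → N`. -/
def counitMap (N : RComod A C) :
    BalTensor (endRing P) (colinearHom P N) P.carrier →ₗ[Aᵐᵒᵖ] N.carrier :=
  evalHom P N.carrier ∘ₗ BalTensor.mapRight (N := P.carrier) (colinearHom P N).subtype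

theorem counitMap_tmul (N : RComod A C) (g : colinearHom P N) (p : P.carrier) :
    counitMap P N (BalTensor.tmul (endRing P) g p) = g.1 p := rfl

theorem counitMap_colinear (N : RComod A C) :
    IsColinear (M := tensorEnd P (colinearHom P N)) (N := N) (counitMap P N) := by
  intro t
  change N.coact (counitMap P N t) = BalTensor.map (counitMap P N) LinearMap.id
      (tensorCoact (endRing P) (colinearHom P N) P (endRing_coact P) t)
  induction t using BalTensor.induction_on with
  | hz => rw [map_zero, map_zero, map_zero, map_zero]
  | ht g p =>
    rw [tensorCoact_tmul, ← BalTensor.map_comp_left, counitMap_tmul, g.2 p]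
    rfl
  | ha x y hx hy => rw [map_add, map_add, map_add, map_add, hx, hy]

/-- The evaluation maps as a natural transformation. -/
def counitTrans : P.homFunctor ⋙ P.tensorFunctor ⟶ 𝟭 (RComod A C) where
  app N := ⟨counitMap P N, counitMap_colinear P N⟩
  naturality M N f := Hom.ext (LinearMap.ext fun t => by
    exact BalTensor.hom_congr
      (f := (counitMap P N).toAddMonoidHom.comp
        (BalTensor.map (P.homFunctor.map f).hom LinearMap.id))
      (g := f.toLinearMap.toAddMonoidHom.comp (counitMap P M).toAddMonoidHom)
      (fun _ _ => rfl) t)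

/-- The maps `X → Hom^C(P, X ⊗_S P)` as a natural transformation. -/
def unitTrans : 𝟭 (ModuleCat.{u} (endRing P)ᵐᵒᵖ) ⟶ P.tensorFunctor ⋙ P.homFunctor where
  app X := ModuleCat.ofHom (unitMap P X)
  naturality X Y f := by
    ext x
    rfl

/-- No triangle identity has to be checked: `Equivalence.mk` corrects one of the two natural
isomorphisms and leaves both functors untouched. -/
theorem exists_equivalence (h₁ : ∀ N : RComod A C, Function.Bijective (counitMap P N))
    (h₂ : ∀ (X : Type u) [AddCommGroup X] [Module (endRing P)ᵐᵒᵖ X],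
      Function.Bijective (unitMap P X)) :
    ∃ e : RComod A C ≌ ModuleCat.{u} (P.endRing)ᵐᵒᵖ,
      e.functor = P.homFunctor ∧ e.inverse = P.tensorFunctor := by
  have i₁ : ∀ N, IsIso ((counitTrans P).app N) := fun N => isIso_of_bijective _ (h₁ N)
  have i₂ : ∀ X, IsIso ((unitTrans P).app X) := fun X =>
    (ConcreteCategory.isIso_iff_bijective _).2 (h₂ X)
  have j₁ : IsIso (counitTrans P) := NatIso.isIso_of_isIso_app _
  have j₂ : IsIso (unitTrans P) := NatIso.isIso_of_isIso_app _
  exact ⟨CategoryTheory.Equivalence.mk P.homFunctor P.tensorFunctor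
    (asIso (counitTrans P)).symm (asIso (unitTrans P)).symm, rfl, rfl⟩

end RComod

/-! ### The Galois isomorphism and the equalizer criterion for the counit -/

namespace RComod

variable {A C : Type u} [Ring A] [AddCommGroup C] [Module A C] [Module Aᵐᵒᵖ C]
  [SMulCommClass A Aᵐᵒᵖ C] [Coring A C]
variable (P : RComod A C)

section Galois

variable (K : Type u) [AddCommGroup K] [Module Aᵐᵒᵖ K]

theorem galoisMap_smul (a : Aᵐᵒᵖ)
    (t : BalTensor (endRing P) (P.carrier →ₗ[Aᵐᵒᵖ] K) P.carrier) :
    galoisMap P K (a • t) = a • galoisMap P K t := by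
  induction t using BalTensor.induction_on with
  | hz => simp
  | ht g p => exact map_smul (BalTensor.mapRight (N := C) g ∘ₗ P.coact) a p
  | ha x y hx hy => simp only [smul_add, map_add, hx, hy]

/-- The map `Hom_A(P, K) → Hom_A(P, K ⊗_A C)`, `g ↦ (g ⊗ I_C) ∘ ρ`. -/
def cofreeHom : (P.carrier →ₗ[Aᵐᵒᵖ] K) →ₗ[(endRing P)ᵐᵒᵖ] (P.carrier →ₗ[Aᵐᵒᵖ] BalTensor A K C) where
  toFun g := BalTensor.mapRight (N := C) g ∘ₗ P.coact
  map_add' f g := LinearMap.ext fun p => BalTensor.map_add_left f g (P.coact p)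
  map_smul' s g := LinearMap.ext fun p => by
    change BalTensor.map (g ∘ₗ (s.unop : Module.End Aᵐᵒᵖ P.carrier)) LinearMap.id (P.coact p) =
      BalTensor.map g LinearMap.id (P.coact (s.unop • p))
    rw [BalTensor.map_comp_left]
    exact congrArg _ (s.unop.2 p).symm

@[simp]
theorem cofreeHom_apply (g : P.carrier →ₗ[Aᵐᵒᵖ] K) (p : P.carrier) :
    cofreeHom P K g p = BalTensor.map g LinearMap.id (P.coact p) := rfl

/-- The coaction `I_K ⊗ Δ` of `K ⊗_A C`. -/
def cofreeCoact : BalTensor A K C →ₗ[Aᵐᵒᵖ] BalTensor A (BalTensor A K C) C :=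
  (cofree (C := C) K).coact

theorem cofreeCoact_apply (t : BalTensor A K C) :
    cofreeCoact K t = BalTensor.assoc A K C A C
      (BalTensor.map LinearMap.id (Coring.comul (A := A) (C := C)).left t) := rfl

/-- For an `A`-linear map `g : K → L`, the map `g ⊗ I_C` is colinear. -/
theorem cofreeCoact_map {K L : Type u} [AddCommGroup K] [Module Aᵐᵒᵖ K] [AddCommGroup L]
    [Module Aᵐᵒᵖ L] (g : K →ₗ[Aᵐᵒᵖ] L) (t : BalTensor A K C) :
    cofreeCoact L (BalTensor.map g LinearMap.id t) =
      BalTensor.map (BalTensor.mapRight g) LinearMap.id (cofreeCoact K t) := by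
  rw [cofreeCoact_apply, cofreeCoact_apply]
  induction t using BalTensor.induction_on with
  | hz => simp
  | ht k c =>
    simp only [BalTensor.map_tmul, LinearMap.id_apply]
    induction (Coring.comul (A := A) (C := C)).left c using BalTensor.induction_on with
    | hz => simp [BalTensor.tmul_zero]
    | ht c d => rfl
    | ha y z hy hz => simp only [BalTensor.tmul_add, map_add, hy, hz]
  | ha x y hx hy => simp only [map_add, hx, hy]

theorem cofreeHom_colinear (g : P.carrier →ₗ[Aᵐᵒᵖ] K) :
    IsColinear (M := P) (N := cofree K) (cofreeHom P K g) := by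
  intro p
  change cofreeCoact K (cofreeHom P K g p) = BalTensor.map (cofreeHom P K g) LinearMap.id (P.coact p)
  rw [cofreeHom_apply, cofreeCoact_map, cofreeCoact_apply, P.coassoc]
  exact (BalTensor.map_comp_left _ _ _).symm

/-- Colinearity of `(g ⊗ I) ∘ ρ`, evaluated at `p`. Together with `galoisMap_postcomp` it translates
the pair of maps defining `Hom^C(P, N)` into the pair `I ⊗ Δ`, `ρ_N ⊗ I`. -/
theorem galoisMap_cofreeHom (t : BalTensor (endRing P) (P.carrier →ₗ[Aᵐᵒᵖ] K) P.carrier) :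
    galoisMap P (BalTensor A K C) (BalTensor.map (cofreeHom P K) LinearMap.id t) =
      cofreeCoact K (galoisMap P K t) := by
  induction t using BalTensor.induction_on with
  | hz => simp only [map_zero]
  | ht g p => exact (cofreeHom_colinear P K g p).symm
  | ha x y hx hy => simp only [map_add, hx, hy]

end Galois

/-- Composition with an `A`-linear map. -/
def postcomp {K L : Type u} [AddCommGroup K] [Module Aᵐᵒᵖ K] [AddCommGroup L]
    [Module Aᵐᵒᵖ L] (k : K →ₗ[Aᵐᵒᵖ] L) :
    (P.carrier →ₗ[Aᵐᵒᵖ] K) →ₗ[(endRing P)ᵐᵒᵖ] (P.carrier →ₗ[Aᵐᵒᵖ] L) where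
  toFun g := k ∘ₗ g
  map_add' f g := LinearMap.comp_add f g k
  map_smul' _ _ := rfl

theorem galoisMap_postcomp {K L : Type u} [AddCommGroup K] [Module Aᵐᵒᵖ K] [AddCommGroup L]
    [Module Aᵐᵒᵖ L] (k : K →ₗ[Aᵐᵒᵖ] L)
    (t : BalTensor (endRing P) (P.carrier →ₗ[Aᵐᵒᵖ] K) P.carrier) :
    galoisMap P L (BalTensor.map (postcomp P k) LinearMap.id t) =
      BalTensor.map k LinearMap.id (galoisMap P K t) := by
  induction t using BalTensor.induction_on with
  | hz => simp
  | ht g p => exact BalTensor.map_comp_left k g (P.coact p)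
  | ha x y hx hy => simp only [map_add, hx, hy]

/-- Colinearity of `g` at `p`. As `ρ_N` is injective, the counit can be studied inside `N ⊗_A C`,
where the Galois property applies. -/
theorem coact_counitMap (N : RComod A C)
    (t : BalTensor (endRing P) (colinearHom P N) P.carrier) :
    N.coact (counitMap P N t) =
      galoisMap P N.carrier (BalTensor.map (colinearHom P N).subtype LinearMap.id t) := by
  induction t using BalTensor.induction_on with
  | hz => rw [map_zero, map_zero, map_zero, map_zero]
  | ht g p => exact g.2 p
  | ha x y hx hy => rw [map_add, map_add, map_add, map_add, hx, hy]

/-- The evaluation map `Hom^C(P, N) ⊗_S P → N` is bijective as soon as `- ⊗_S P` preserves the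
equalizer defining `Hom^C(P, N)`. -/
theorem counitMap_bijective_of_equalizer (hP : P.IsGalois) (N : RComod A C)
    (h₁ : Function.Injective (BalTensor.map (colinearHom P N).subtype
      (LinearMap.id : P.carrier →ₗ[endRing P] P.carrier)))
    (h₂ : ∀ z : BalTensor (endRing P) (P.carrier →ₗ[Aᵐᵒᵖ] N.carrier) P.carrier,
      BalTensor.map (postcomp P N.coact) LinearMap.id z =
        BalTensor.map (cofreeHom P N.carrier) LinearMap.id z →
      ∃ w, BalTensor.map (colinearHom P N).subtype LinearMap.id w = z) :
    Function.Bijective (counitMap P N) := by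
  constructor
  · intro x y hxy
    apply h₁
    apply (hP N.carrier).1
    rw [← coact_counitMap, ← coact_counitMap, hxy]
  · intro n
    obtain ⟨z, hz⟩ := (hP N.carrier).2 (N.coact n)
    -- Coassociativity of `N` says that `ρ_N ⊗ I` and `I ⊗ Δ` agree on `ρ_N(n)`; injectivity of the
    -- Galois map pulls this back to `z`.
    obtain ⟨w, hw⟩ := h₂ z (by
      apply (hP _).1
      rw [galoisMap_postcomp, galoisMap_cofreeHom, hz, cofreeCoact_apply, N.coassoc])
    refine ⟨w, N.coact_injective ?_⟩
    rw [coact_counitMap, hw, hz]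

/-- The equalizer is the kernel of the difference `d` of the two maps, and a flat module preserves
kernels. -/
theorem counitMap_bijective_of_isFlatLeft (hP : P.IsGalois)
    (hf : IsFlatLeft P.endRing P.carrier) (N : RComod A C) :
    Function.Bijective (counitMap P N) := by
  refine counitMap_bijective_of_equalizer P hP N (hf _ _ _ (Submodule.subtype_injective _)) ?_
  intro z hz
  let d := postcomp P N.coact - cofreeHom P N.carrier
  have hd : BalTensor.map d LinearMap.id z = 0 := by
    rw [BalTensor.map_sub_left, hz, sub_self]
  -- Right exactness applies only to a surjection, so `d` is corestricted to its range; by flatness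
  -- the inclusion of the range stays injective after tensoring.
  have hd' : BalTensor.map d.rangeRestrict LinearMap.id z = 0 := by
    apply hf _ _ (LinearMap.range d).subtype (Submodule.subtype_injective _)
    rw [← BalTensor.map_comp_left, map_zero]
    exact hd
  refine (BalTensor.map_exact (f := (colinearHom P N).subtype) (g := d.rangeRestrict)
    (fun g => ?_) d.surjective_rangeRestrict z).1 hd'
  have e : d.rangeRestrict g = 0 ↔ d g = 0 := Subtype.ext_iff
  rw [e, show d g = postcomp P N.coact g - cofreeHom P N.carrier g from rfl, sub_eq_zero]
  constructor
  · intro h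
    exact ⟨⟨g, fun p => LinearMap.congr_fun h p⟩, rfl⟩
  · rintro ⟨g, rfl⟩
    exact LinearMap.ext g.2

end RComod

theorem BalTensor.map_sum_left {R X Y N ι : Type*} [Ring R] [AddCommGroup X] [Module Rᵐᵒᵖ X]
    [AddCommGroup Y] [Module Rᵐᵒᵖ Y] [AddCommGroup N] [Module R N] (s : Finset ι)
    (f : ι → X →ₗ[Rᵐᵒᵖ] Y) (t : BalTensor R X N) :
    BalTensor.map (∑ i ∈ s, f i) (LinearMap.id : N →ₗ[R] N) t =
      ∑ i ∈ s, BalTensor.map (f i) LinearMap.id t :=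
  map_sum (AddMonoidHom.mk' (fun f => BalTensor.map f (LinearMap.id : N →ₗ[R] N) t)
    (fun f g => BalTensor.map_add_left f g t)) _ _

/-! ### Strongly relatively injective Galois comodules -/

namespace RComod

variable {A C : Type u} [Ring A] [AddCommGroup C] [Module A C] [Module Aᵐᵒᵖ C]
  [SMulCommClass A Aᵐᵒᵖ C] [Coring A C]
variable (P : RComod A C)

section Splitting

variable (l : BalTensor A P.carrier C →ₗ[Aᵐᵒᵖ] P.carrier)
  (hlS : ∀ (s : endRing P) (t : BalTensor A P.carrier C), l (s • t) = s • l t)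

section Counit

variable (K : Type u) [AddCommGroup K] [Module Aᵐᵒᵖ K]

/-- The map `Hom_A(P, K) ⊗_S P → K`, `g ⊗ p ↦ g(l(p ⊗ c))`. -/
def evalSplit (c : C) : BalTensor (endRing P) (P.carrier →ₗ[Aᵐᵒᵖ] K) P.carrier →+ K :=
  BalTensor.lift' (fun g p => g (l (BalTensor.tmul A p c))) (fun _ _ _ => rfl)
    (by simp [BalTensor.add_tmul])
    -- Left `S`-linearity of `l` is what makes the formula balanced over `S`.
    (fun g s p => by
      rw [← BalTensor.smul_tmul_left, hlS]
      rfl)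

theorem evalSplit_tmul (c : C) (g : P.carrier →ₗ[Aᵐᵒᵖ] K) (p : P.carrier) :
    evalSplit P l hlS K c (BalTensor.tmul (endRing P) g p) = g (l (BalTensor.tmul A p c)) := rfl

theorem evalSplit_add (c d : C) (t : BalTensor (endRing P) (P.carrier →ₗ[Aᵐᵒᵖ] K) P.carrier) :
    evalSplit P l hlS K (c + d) t = evalSplit P l hlS K c t + evalSplit P l hlS K d t := by
  rw [← AddMonoidHom.add_apply]
  exact BalTensor.hom_congr (fun g p => by simp [evalSplit_tmul, BalTensor.tmul_add]) t

theorem evalSplit_smul (a : A) (c : C)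
    (t : BalTensor (endRing P) (P.carrier →ₗ[Aᵐᵒᵖ] K) P.carrier) :
    evalSplit P l hlS K (a • c) t = evalSplit P l hlS K c (MulOpposite.op a • t) := by
  induction t using BalTensor.induction_on with
  | hz => simp
  | ht g p =>
    rw [BalTensor.smul_tmul_right, evalSplit_tmul, evalSplit_tmul, BalTensor.smul_tmul]
  | ha x y hx hy => simp only [smul_add, map_add, hx, hy]

theorem evalSplit_op_smul (a : Aᵐᵒᵖ) (c : C)
    (t : BalTensor (endRing P) (P.carrier →ₗ[Aᵐᵒᵖ] K) P.carrier) :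
    evalSplit P l hlS K (a • c) t = a • evalSplit P l hlS K c t := by
  induction t using BalTensor.induction_on with
  | hz => simp
  | ht g p =>
    rw [evalSplit_tmul, evalSplit_tmul, ← BalTensor.smul_tmul_right, map_smul, map_smul]
  | ha x y hx hy => simp only [smul_add, map_add, hx, hy]

variable (hP : P.IsGalois)

/-- The isomorphism `Hom_A(P, K) ⊗_S P ≅ K ⊗_A C` of a Galois comodule. -/
noncomputable def galoisEquiv :
    BalTensor (endRing P) (P.carrier →ₗ[Aᵐᵒᵖ] K) P.carrier ≃+ BalTensor A K C :=
  AddEquiv.ofBijective (galoisMap P K) (hP K)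

theorem galoisEquiv_symm_smul (a : Aᵐᵒᵖ) (y : BalTensor A K C) :
    (galoisEquiv P K hP).symm (a • y) = a • (galoisEquiv P K hP).symm y := by
  rw [AddEquiv.symm_apply_eq]
  conv_lhs => rw [← (galoisEquiv P K hP).apply_symm_apply y]
  exact (galoisMap_smul P K a _).symm

/-- The map `(K ⊗_A C) ⊗_A C → K` that sends `(g ⊗ I_C)(ρ(p)) ⊗ c` to `g(l(p ⊗ c))`. -/
noncomputable def splitEval : BalTensor A (BalTensor A K C) C →ₗ[Aᵐᵒᵖ] K where
  toFun := BalTensor.lift'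
    (fun y c => evalSplit P l hlS K c ((galoisEquiv P K hP).symm y))
    (by simp) (by intro y c d; exact evalSplit_add P l hlS K c d _)
    (by intro y a c; rw [galoisEquiv_symm_smul, evalSplit_smul])
  map_add' := map_add _
  map_smul' a t := by
    induction t using BalTensor.induction_on with
    | hz => simp
    | ht y c => exact evalSplit_op_smul P l hlS K a c _
    | ha x y hx hy => simp only [smul_add, map_add, hx, hy]

theorem splitEval_tmul (g : P.carrier →ₗ[Aᵐᵒᵖ] K) (p : P.carrier) (c : C) :
    splitEval P l hlS K hP (BalTensor.tmul A (cofreeHom P K g p) c) =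
      g (l (BalTensor.tmul A p c)) :=
  congrArg (evalSplit P l hlS K c)
    ((galoisEquiv P K hP).symm_apply_apply (BalTensor.tmul (endRing P) g p))

theorem splitEval_map (g : P.carrier →ₗ[Aᵐᵒᵖ] K) (t : BalTensor A P.carrier C) :
    splitEval P l hlS K hP (BalTensor.map (cofreeHom P K g) LinearMap.id t) = g (l t) := by
  induction t using BalTensor.induction_on with
  | hz => simp
  | ht p c => exact splitEval_tmul P l hlS K hP g p c
  | ha x y hx hy => simp only [map_add, hx, hy]

/-- Surjectivity of the Galois map: `K ⊗_A C` is generated by the elements `(k ⊗ I)(ρ(p))`, on which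
`splitEval` has an explicit value. -/
theorem hom_congr_of_isGalois (hP : P.IsGalois) {Q : Type*} [AddCommGroup Q]
    {f g : BalTensor A (BalTensor A K C) C →+ Q}
    (h : ∀ (k : P.carrier →ₗ[Aᵐᵒᵖ] K) (p : P.carrier) (c : C),
      f (BalTensor.tmul A (cofreeHom P K k p) c) = g (BalTensor.tmul A (cofreeHom P K k p) c))
    (t : BalTensor A (BalTensor A K C) C) : f t = g t := by
  refine BalTensor.hom_congr (fun y c => ?_) t
  obtain ⟨z, rfl⟩ := (hP K).2 y
  induction z using BalTensor.induction_on with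
  | hz => simp [BalTensor.zero_tmul]
  | ht k p => exact h k p c
  | ha x y hx hy => simp only [map_add, BalTensor.add_tmul, hx, hy]

theorem splitEval_natural {L : Type u} [AddCommGroup L] [Module Aᵐᵒᵖ L] (k : K →ₗ[Aᵐᵒᵖ] L)
    (t : BalTensor A (BalTensor A K C) C) :
    splitEval P l hlS L hP (BalTensor.map (BalTensor.mapRight k) LinearMap.id t) =
      k (splitEval P l hlS K hP t) := by
  refine hom_congr_of_isGalois P K hP
    (f := (splitEval P l hlS L hP).toAddMonoidHom.comp
      (BalTensor.map (BalTensor.mapRight k) LinearMap.id))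
    (g := k.toAddMonoidHom.comp (splitEval P l hlS K hP).toAddMonoidHom) (fun g p c => ?_) t
  have e : BalTensor.mapRight (N := C) (T := A) k (cofreeHom P K g p) = cofreeHom P L (k ∘ₗ g) p :=
    (BalTensor.map_comp_left k g (P.coact p)).symm
  change splitEval P l hlS L hP (BalTensor.tmul A (BalTensor.mapRight k (cofreeHom P K g p)) c) =
    k (splitEval P l hlS K hP (BalTensor.tmul A (cofreeHom P K g p) c))
  rw [e, splitEval_tmul, splitEval_tmul]
  rfl

/-- On a generator given by `g`, `p`, `c`, both sides equal `(g ⊗ I)(ρ(l(p ⊗ c)))`: the left side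
because `(g ⊗ I) ∘ ρ` is colinear, the right side because `l` is. -/
theorem splitEval_cofreeCoact
    (hl : ∀ t, P.coact (l t) = BalTensor.map l LinearMap.id (cofreeCoact P.carrier t))
    (t : BalTensor A (BalTensor A K C) C) :
    splitEval P l hlS (BalTensor A K C) hP (BalTensor.map (cofreeCoact K) LinearMap.id t) =
      BalTensor.map (splitEval P l hlS K hP) LinearMap.id (cofreeCoact (BalTensor A K C) t) := by
  refine hom_congr_of_isGalois P K hP
    (f := (splitEval P l hlS (BalTensor A K C) hP).toAddMonoidHom.comp
      (BalTensor.map (cofreeCoact K) LinearMap.id))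
    (g := (BalTensor.map (splitEval P l hlS K hP) LinearMap.id).comp
      (cofreeCoact (BalTensor A K C)).toAddMonoidHom) (fun g p c => ?_) t
  have e₁ : cofreeCoact K (cofreeHom P K g p) =
      cofreeHom P (BalTensor A K C) (cofreeHom P K g) p := cofreeHom_colinear P K g p
  have e₂ : splitEval P l hlS K hP ∘ₗ BalTensor.mapRight (N := C) (cofreeHom P K g) = g ∘ₗ l :=
    LinearMap.ext (splitEval_map P l hlS K hP g)
  change splitEval P l hlS (BalTensor A K C) hP
      (BalTensor.tmul A (cofreeCoact K (cofreeHom P K g p)) c) =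
    BalTensor.map (splitEval P l hlS K hP) LinearMap.id (cofreeCoact (BalTensor A K C)
      (BalTensor.map (cofreeHom P K g) LinearMap.id (BalTensor.tmul A p c)))
  rw [e₁, splitEval_tmul, cofreeHom_apply, hl, cofreeCoact_map, ← BalTensor.map_comp_left,
    ← BalTensor.map_comp_left, e₂]

/-- If `P` is a strongly `(C, A)`-injective Galois comodule, then every right comodule `N` is
`(C, A)`-injective. -/
theorem splitEval_colinear
    (hl : ∀ t, P.coact (l t) = BalTensor.map l LinearMap.id (cofreeCoact P.carrier t))
    (N : RComod A C) (t : BalTensor A N.carrier C) :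
    N.coact (splitEval P l hlS N.carrier hP (BalTensor.map N.coact LinearMap.id t)) =
      BalTensor.map (splitEval P l hlS N.carrier hP ∘ₗ BalTensor.mapRight N.coact) LinearMap.id
        (cofreeCoact N.carrier t) := by
  have e : BalTensor.mapRight (N := C) N.coact ∘ₗ N.coact = cofreeCoact N.carrier ∘ₗ N.coact :=
    LinearMap.ext fun n => (N.coassoc n).symm
  rw [← splitEval_natural, ← BalTensor.map_comp_left, e, BalTensor.map_comp_left,
    splitEval_cofreeCoact P l hlS _ hP hl, cofreeCoact_map, BalTensor.map_comp_left]

end Counit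

/-- The splitting turns the equalizer defining `Hom^C(P, N)` into a split one: `T` retracts one of
the two parallel maps, and composed with the other it takes colinear values. These are identities
between `S`-linear maps, so they persist after `- ⊗_S P`. -/
theorem counitMap_bijective_of_splitting (hP : P.IsGalois)
    (hlS : ∀ (s : endRing P) (t : BalTensor A P.carrier C), l (s • t) = s • l t)
    (hl : ∀ t, P.coact (l t) = BalTensor.map l LinearMap.id (cofreeCoact P.carrier t))
    (hlρ : ∀ p, l (P.coact p) = p) (N : RComod A C) : Function.Bijective (counitMap P N) := by
  let T : (P.carrier →ₗ[Aᵐᵒᵖ] BalTensor A N.carrier C) →ₗ[(endRing P)ᵐᵒᵖ]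
      (P.carrier →ₗ[Aᵐᵒᵖ] N.carrier) :=
    postcomp P (splitEval P l hlS N.carrier hP) ∘ₗ cofreeHom P (BalTensor A N.carrier C)
  have hT : T ∘ₗ cofreeHom P N.carrier = LinearMap.id := by
    ext g p
    exact (splitEval_map P l hlS N.carrier hP g (P.coact p)).trans (congrArg g (hlρ p))
  -- The values are colinear because they factor as the colinear `(g ⊗ I) ∘ ρ : P → N ⊗_A C`
  -- followed by the colinear map `N ⊗_A C → N` of `splitEval_colinear`.
  let r : (P.carrier →ₗ[Aᵐᵒᵖ] N.carrier) →ₗ[(endRing P)ᵐᵒᵖ] colinearHom P N :=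
    (T ∘ₗ postcomp P N.coact).codRestrict (colinearHom P N) (by
      intro g
      have e : (T ∘ₗ postcomp P N.coact) g =
          (splitEval P l hlS N.carrier hP ∘ₗ BalTensor.mapRight N.coact) ∘ₗ
            cofreeHom P N.carrier g :=
        LinearMap.ext fun p => congrArg (splitEval P l hlS N.carrier hP)
          (BalTensor.map_comp_left N.coact g (P.coact p))
      rw [e]
      exact isColinear_comp (L := P) (M := cofree N.carrier) (N := N)
        (splitEval_colinear P l hlS hP hl N) (cofreeHom_colinear P N.carrier g))
  have hr : r ∘ₗ (colinearHom P N).subtype = LinearMap.id := by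
    ext1 g
    apply Subtype.ext
    have e : postcomp P N.coact g.1 = cofreeHom P N.carrier g.1 := LinearMap.ext g.2
    exact (congrArg T e).trans (LinearMap.congr_fun hT g.1)
  refine counitMap_bijective_of_equalizer P hP N ?_ ?_
  · intro x y hxy
    have := congrArg (BalTensor.map r (LinearMap.id : P.carrier →ₗ[endRing P] P.carrier)) hxy
    rwa [← BalTensor.map_comp_left, ← BalTensor.map_comp_left, hr, BalTensor.map_id,
      BalTensor.map_id] at this
  · intro z hz
    refine ⟨BalTensor.map r LinearMap.id z, ?_⟩
    have := congrArg (BalTensor.map T (LinearMap.id : P.carrier →ₗ[endRing P] P.carrier)) hz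
    rw [← BalTensor.map_comp_left, ← BalTensor.map_comp_left, hT, BalTensor.map_id] at this
    rw [← BalTensor.map_comp_left]
    exact this

section Unit

variable (hl : ∀ t, P.coact (l t) = BalTensor.map l LinearMap.id (cofreeCoact P.carrier t))

/-- The map `End_A(P) → S`, `f ↦ l ∘ (f ⊗ I_C) ∘ ρ`. -/
def endSplit : (P.carrier →ₗ[Aᵐᵒᵖ] P.carrier) →+ endRing P :=
  AddMonoidHom.mk' (fun f => ⟨l ∘ₗ cofreeHom P P.carrier f,
      isColinear_comp (L := P) (M := cofree P.carrier) (N := P) hl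
        (cofreeHom_colinear P P.carrier f)⟩)
    (fun f g => Subtype.ext (by
      change l ∘ₗ cofreeHom P P.carrier (f + g) =
        l ∘ₗ cofreeHom P P.carrier f + l ∘ₗ cofreeHom P P.carrier g
      rw [map_add, LinearMap.comp_add]))

theorem endSplit_smul (f : P.carrier →ₗ[Aᵐᵒᵖ] P.carrier) (q : P.carrier) :
    endSplit P l hl f • q = l (BalTensor.map f LinearMap.id (P.coact q)) := rfl

/-- Left `S`-linearity of the retraction onto `S`, which follows from that of `l`; it is needed for
`tensorSplit` to be balanced. -/
theorem endSplit_comp (hlS : ∀ (s : endRing P) (t : BalTensor A P.carrier C), l (s • t) = s • l t)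
    (s : endRing P) (f : P.carrier →ₗ[Aᵐᵒᵖ] P.carrier) :
    endSplit P l hl ((s : Module.End Aᵐᵒᵖ P.carrier) ∘ₗ f) = s * endSplit P l hl f := by
  apply Subtype.ext
  ext q
  change l (BalTensor.map ((s : Module.End Aᵐᵒᵖ P.carrier) ∘ₗ f) LinearMap.id (P.coact q)) =
    s • l (BalTensor.map f LinearMap.id (P.coact q))
  rw [BalTensor.map_comp_left, ← hlS]
  rfl

theorem endSplit_id (hlρ : ∀ p, l (P.coact p) = p) : endSplit P l hl LinearMap.id = 1 := by
  apply Subtype.ext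
  ext q
  change l (BalTensor.map LinearMap.id LinearMap.id (P.coact q)) = q
  rw [BalTensor.map_id, hlρ]

variable (X : Type u) [AddCommGroup X] [Module (endRing P)ᵐᵒᵖ X]

/-- The map `X ⊗_S P → X`, `x ⊗ p ↦ x · (l ∘ (p h(-) ⊗ I_C) ∘ ρ)`, for `h ∈ P*`. -/
def tensorSplit (h : P.carrier →ₗ[Aᵐᵒᵖ] A) : BalTensor (endRing P) X P.carrier →+ X :=
  BalTensor.lift'
    (fun x p => MulOpposite.op (endSplit P l hl (dualEval (BalTensor.tmul A p h))) • x)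
    (by simp) (by simp [BalTensor.add_tmul, add_smul])
    (by
      intro x s p
      rw [← mul_smul, ← MulOpposite.op_mul, ← endSplit_comp P l hl hlS]
      have e : (s : Module.End Aᵐᵒᵖ P.carrier) ∘ₗ dualEval (BalTensor.tmul A p h) =
          dualEval (BalTensor.tmul A (s • p) h) :=
        LinearMap.ext fun q => map_smul (s : Module.End Aᵐᵒᵖ P.carrier) _ p
      rw [e])

theorem tensorSplit_tmul (h : P.carrier →ₗ[Aᵐᵒᵖ] A) (x : X) (p : P.carrier) :
    tensorSplit P l hlS hl X h (BalTensor.tmul (endRing P) x p) =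
      MulOpposite.op (endSplit P l hl (dualEval (BalTensor.tmul A p h))) • x := rfl

/-- The map `I_X ⊗ l`. -/
def tensorRetract :
    BalTensor A (BalTensor (endRing P) X P.carrier) C →+ BalTensor (endRing P) X P.carrier :=
  (BalTensor.map (LinearMap.id : X →ₗ[(endRing P)ᵐᵒᵖ] X)
    (⟨l.toAddHom, hlS⟩ : BalTensor A P.carrier C →ₗ[endRing P] P.carrier)).comp
    (BalTensor.assoc (endRing P) X P.carrier A C).symm.toAddMonoidHom

theorem tensorRetract_map (x : X) (t : BalTensor A P.carrier C) :
    tensorRetract P l hlS X (BalTensor.map (BalTensor.tmulLeft (endRing P) x) LinearMap.id t) =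
      BalTensor.tmul (endRing P) x (l t) := by
  induction t using BalTensor.induction_on with
  | hz => simp [BalTensor.tmul_zero]
  | ht p c => rfl
  | ha y z hy hz => simp only [map_add, BalTensor.tmul_add, hy, hz]

/-- Moving the element of `S` across the tensor sign lets it act on `q`, where it is given by `l`.
The result depends additively on the map `y h(-)`, so a sum over a dual basis can be collapsed. -/
theorem tmul_tensorSplit (h : P.carrier →ₗ[Aᵐᵒᵖ] A) (y : BalTensor (endRing P) X P.carrier)
    (q : P.carrier) :
    BalTensor.tmul (endRing P) (tensorSplit P l hlS hl X h y) q =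
      tensorRetract P l hlS X
        (BalTensor.map (dualEval (BalTensor.tmul A y h)) LinearMap.id (P.coact q)) := by
  induction y using BalTensor.induction_on with
  | hz => simp [BalTensor.zero_tmul, BalTensor.map_zero_left]
  | ht x p =>
    have e : dualEval (BalTensor.tmul A (BalTensor.tmul (endRing P) x p) h) =
        BalTensor.tmulLeft (endRing P) x ∘ₗ dualEval (BalTensor.tmul A p h) := rfl
    rw [tensorSplit_tmul, e, BalTensor.map_comp_left, tensorRetract_map, BalTensor.smul_tmul,
      endSplit_smul]
  | ha y z hy hz =>
    simp only [map_add, BalTensor.add_tmul, hy, hz, BalTensor.map_add_left]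

/-- For a dual basis `p i`, `π i`, the identity of `P` is the sum of the maps `p i · π i(-)`, and
the retraction onto `S` sends it to `1`. This dictates the inverse `θ`. The Galois property plays no
role here. -/
theorem unitMap_bijective_of_splitting [Module.Finite Aᵐᵒᵖ P.carrier]
    [Module.Projective Aᵐᵒᵖ P.carrier]
    (hlS : ∀ (s : endRing P) (t : BalTensor A P.carrier C), l (s • t) = s • l t)
    (hl : ∀ t, P.coact (l t) = BalTensor.map l LinearMap.id (cofreeCoact P.carrier t))
    (hlρ : ∀ p, l (P.coact p) = p) : Function.Bijective (unitMap P X) := by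
  obtain ⟨n, p, π, hp⟩ := exists_dual_basis A P.carrier
  have hsum : ∀ {K : Type u} [AddCommGroup K] [Module Aᵐᵒᵖ K] (f : P.carrier →ₗ[Aᵐᵒᵖ] K),
      ∑ i, dualEval (BalTensor.tmul A (f (p i)) (π i)) = f := by
    intro K _ _ f
    ext m
    conv_rhs => rw [← hp m, map_sum]
    simp
  let θ : colinearHom P (tensorEnd P X) → X :=
    fun f => ∑ i, tensorSplit P l hlS hl X (π i) (f.1 (p i))
  refine Function.bijective_iff_has_inverse.2 ⟨θ, fun x => ?_, fun f => ?_⟩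
  · change ∑ i, MulOpposite.op (endSplit P l hl (dualEval (BalTensor.tmul A (p i) (π i)))) • x = x
    rw [← Finset.sum_smul, ← Finset.op_sum, ← map_sum]
    rw [show ∑ i, dualEval (BalTensor.tmul A (p i) (π i)) = LinearMap.id from
      hsum LinearMap.id, endSplit_id P l hl hlρ, MulOpposite.op_one, one_smul]
  · apply Subtype.ext
    ext q
    let g : P.carrier →ₗ[Aᵐᵒᵖ] BalTensor (endRing P) X P.carrier := f.1
    have hg : ∀ q, tensorCoact (endRing P) X P (endRing_coact P) (g q) =
      BalTensor.map g LinearMap.id (P.coact q) := f.2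
    change BalTensor.tmul (endRing P) (∑ i, tensorSplit P l hlS hl X (π i) (g (p i))) q = g q
    rw [BalTensor.sum_tmul]
    simp only [tmul_tensorSplit]
    -- The maps `g(p i) π i(-)` add up to `g`, and colinearity of `g` replaces `(g ⊗ I)(ρ(q))` by
    -- the coaction of `g q`, which `I_X ⊗ l` splits.
    rw [← map_sum, ← BalTensor.map_sum_left, hsum, ← hg]
    generalize g q = y
    induction y using BalTensor.induction_on with
    | hz => simp
    | ht x p => rw [tensorCoact_tmul, tensorRetract_map, hlρ]
    | ha y z hy hz => rw [map_add, map_add, hy, hz]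

end Unit

end Splitting

/-! ### Coseparable corings -/

section Coseparable

variable (π : BimodHom A (BalTensor A C C) C) (K : Type u) [AddCommGroup K] [Module Aᵐᵒᵖ K]

/-- The map `(K ⊗_A C) ⊗_A C → K`, `(k ⊗ d) ⊗ c ↦ k ε(π(d ⊗ c))`. -/
def cosepEval : BalTensor A (BalTensor A K C) C →ₗ[Aᵐᵒᵖ] K where
  toFun t := BalTensor.rid (BalTensor.map LinearMap.id
    ((Coring.counit (A := A) (C := C)).left ∘ₗ π.left) ((BalTensor.assoc A K C A C).symm t))
  map_add' := by simp
  map_smul' a t := by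
    induction t using BalTensor.induction_on with
    | hz => simp
    | ht y c =>
      induction y using BalTensor.induction_on with
      | hz => simp [BalTensor.zero_tmul]
      | ht k d =>
        have e : (Coring.counit (A := A) (C := C)).left (π.left (a • BalTensor.tmul A d c)) =
            a • (Coring.counit (A := A) (C := C)).left (π.left (BalTensor.tmul A d c)) :=
          map_smul ((Coring.counit (A := A) (C := C)).right ∘ₗ π.right) a (BalTensor.tmul A d c)
        change MulOpposite.op ((Coring.counit (A := A) (C := C)).left
            (π.left (a • BalTensor.tmul A d c))) • k =
          a • MulOpposite.op ((Coring.counit (A := A) (C := C)).left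
            (π.left (BalTensor.tmul A d c))) • k
        rw [e, ← mul_smul, ← MulOpposite.op_unop a, op_smul_eq_mul, MulOpposite.op_mul]
      | ha x y hx hy => simp only [BalTensor.add_tmul, smul_add, map_add, hx, hy]
    | ha x y hx hy => simp only [smul_add, map_add, hx, hy]

theorem cosepEval_natural {L : Type u} [AddCommGroup L] [Module Aᵐᵒᵖ L] (k : K →ₗ[Aᵐᵒᵖ] L)
    (t : BalTensor A (BalTensor A K C) C) :
    cosepEval π L (BalTensor.map (BalTensor.mapRight k) LinearMap.id t) = k (cosepEval π K t) :=
  BalTensor.hom_congr₂ (f := (cosepEval π L).toAddMonoidHom.comp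
      (BalTensor.map (BalTensor.mapRight k) LinearMap.id))
    (g := k.toAddMonoidHom.comp (cosepEval π K).toAddMonoidHom)
    (fun x d c => (map_smul k (MulOpposite.op ((Coring.counit (A := A) (C := C)).left
      (π.left (BalTensor.tmul A d c)))) x).symm) t

/-- Applying `I ⊗ ε` to the left colinearity of `π` gives `π(d ⊗ c) = d₁ ε(π(d₂ ⊗ c))`. -/
theorem cosepEval_cofreeCoact_map
    (h : ∀ t, (Coring.comul (A := A) (C := C)).left (π.left t) =
      BalTensor.map LinearMap.id π.left ((BalTensor.assoc A C C A C).symm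
        (BalTensor.map (Coring.comul (A := A) (C := C)).right LinearMap.id t)))
    (t : BalTensor A (BalTensor A K C) C) :
    cosepEval π (BalTensor A K C) (BalTensor.map (cofreeCoact K) LinearMap.id t) =
      BalTensor.map LinearMap.id π.left ((BalTensor.assoc A K C A C).symm t) := by
  refine BalTensor.hom_congr₂ (f := (cosepEval π (BalTensor A K C)).toAddMonoidHom.comp
      (BalTensor.map (cofreeCoact K) LinearMap.id))
    (g := (BalTensor.map LinearMap.id π.left).comp
      (BalTensor.assoc A K C A C).symm.toAddMonoidHom) (fun k d c => ?_) t
  have h' := congrArg BalTensor.rid (congrArg (BalTensor.map LinearMap.id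
    (Coring.counit (A := A) (C := C)).left) (h (BalTensor.tmul A d c)))
  rw [Coring.comul_counit] at h'
  change cosepEval π (BalTensor A K C) (BalTensor.tmul A (BalTensor.assoc A K C A C
      (BalTensor.tmul A k ((Coring.comul (A := A) (C := C)).left d))) c) =
    BalTensor.tmul A k (π.left (BalTensor.tmul A d c))
  rw [h']
  change _ = BalTensor.tmul A k (BalTensor.rid (BalTensor.map LinearMap.id
    (Coring.counit (A := A) (C := C)).left (BalTensor.map LinearMap.id π.left
      ((BalTensor.assoc A C C A C).symm
        (BalTensor.tmul A ((Coring.comul (A := A) (C := C)).left d) c)))))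
  induction (Coring.comul (A := A) (C := C)).left d using BalTensor.induction_on with
  | hz => simp [BalTensor.tmul_zero, BalTensor.zero_tmul]
  | ht d d' => rfl
  | ha x y hx hy => simp only [BalTensor.tmul_add, BalTensor.add_tmul, map_add, hx, hy]

/-- Applying `ε ⊗ I` to the right colinearity of `π` gives `π(d ⊗ c) = ε(π(d ⊗ c₁)) c₂`. The
right-hand side is the same as in `cosepEval_cofreeCoact_map`; comparing the two yields colinearity
of the splitting. -/
theorem map_cosepEval_cofreeCoact
    (h : ∀ t, (Coring.comul (A := A) (C := C)).left (π.left t) =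
      BalTensor.map π.right LinearMap.id (BalTensor.assoc A C C A C
        (BalTensor.map LinearMap.id (Coring.comul (A := A) (C := C)).left t)))
    (t : BalTensor A (BalTensor A K C) C) :
    BalTensor.map (cosepEval π K) LinearMap.id (cofreeCoact (BalTensor A K C) t) =
      BalTensor.map LinearMap.id π.left ((BalTensor.assoc A K C A C).symm t) := by
  refine BalTensor.hom_congr₂ (f := (BalTensor.map (cosepEval π K) LinearMap.id).comp
      (cofreeCoact (BalTensor A K C)).toAddMonoidHom)
    (g := (BalTensor.map LinearMap.id π.left).comp
      (BalTensor.assoc A K C A C).symm.toAddMonoidHom) (fun k d c => ?_) t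
  have h' := congrArg BalTensor.lid (congrArg (BalTensor.map
    (Coring.counit (A := A) (C := C)).right LinearMap.id) (h (BalTensor.tmul A d c)))
  rw [Coring.counit_comul] at h'
  change BalTensor.map (cosepEval π K) LinearMap.id (BalTensor.assoc A (BalTensor A K C) C A C
      (BalTensor.tmul A (BalTensor.tmul A k d) ((Coring.comul (A := A) (C := C)).left c))) =
    BalTensor.tmul A k (π.left (BalTensor.tmul A d c))
  rw [h']
  change _ = BalTensor.tmul A k (BalTensor.lid (BalTensor.map
    (Coring.counit (A := A) (C := C)).right LinearMap.id (BalTensor.map π.right LinearMap.id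
      (BalTensor.assoc A C C A C
        (BalTensor.tmul A d ((Coring.comul (A := A) (C := C)).left c))))))
  induction (Coring.comul (A := A) (C := C)).left c using BalTensor.induction_on with
  | hz => simp [BalTensor.tmul_zero]
  | ht c c' => exact BalTensor.smul_tmul A _ _ _
  | ha x y hx hy => simp only [BalTensor.tmul_add, map_add, hx, hy]

theorem cosepEval_comul (h : ∀ c : C, π.left ((Coring.comul (A := A) (C := C)).left c) = c)
    (t : BalTensor A K C) :
    cosepEval π K (cofreeCoact K t) =
      BalTensor.rid (BalTensor.map LinearMap.id (Coring.counit (A := A) (C := C)).left t) := by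
  change BalTensor.rid (BalTensor.map LinearMap.id
    ((Coring.counit (A := A) (C := C)).left ∘ₗ π.left) ((BalTensor.assoc A K C A C).symm
      (BalTensor.assoc A K C A C (BalTensor.map LinearMap.id
        (Coring.comul (A := A) (C := C)).left t)))) = _
  rw [AddEquiv.symm_apply_apply]
  induction t using BalTensor.induction_on with
  | hz => simp
  | ht k c => simp [h]
  | ha x y hx hy => simp only [map_add, hx, hy]

end Coseparable

/-- A coseparable coring has only strongly `(C, A)`-injective comodules. -/
theorem isStronglyRelInjective_of_isCoseparable (h : IsCoseparable A C) :
    P.IsStronglyRelInjective := by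
  obtain ⟨π, hπ, hπl, hπr⟩ := h
  have e : BalTensor.mapRight (N := C) P.coact ∘ₗ P.coact = cofreeCoact P.carrier ∘ₗ P.coact :=
    LinearMap.ext fun n => (P.coassoc n).symm
  -- The splitting is `p ⊗ c ↦ p₀ ε(π(p₁ ⊗ c))`.
  refine ⟨cosepEval π P.carrier ∘ₗ BalTensor.mapRight P.coact, fun (t : BalTensor A P.carrier C) => ?_,
    fun p => ?_, fun s t => ?_⟩
  · change P.coact (cosepEval π P.carrier (BalTensor.map P.coact LinearMap.id t)) =
      BalTensor.map (cosepEval π P.carrier ∘ₗ BalTensor.mapRight P.coact) LinearMap.id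
        (cofreeCoact P.carrier t)
    -- Both sides reduce to `I ⊗ π` applied to `(ρ ⊗ I)(t)`.
    rw [← cosepEval_natural, ← BalTensor.map_comp_left, e, BalTensor.map_comp_left,
      cosepEval_cofreeCoact_map π _ hπl, BalTensor.map_comp_left, ← cofreeCoact_map,
      map_cosepEval_cofreeCoact π _ hπr]
  · change cosepEval π P.carrier (BalTensor.map P.coact LinearMap.id (P.coact p)) = p
    rw [← P.coassoc]
    exact (cosepEval_comul π P.carrier hπ (P.coact p)).trans (P.counit p)
  -- The splitting is natural for colinear maps, hence commutes with the elements of `S`.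
  · have e : P.coact ∘ₗ (s : Module.End Aᵐᵒᵖ P.carrier) =
        BalTensor.mapRight (N := C) (s : Module.End Aᵐᵒᵖ P.carrier) ∘ₗ P.coact :=
      LinearMap.ext s.2
    change cosepEval π P.carrier (BalTensor.map P.coact LinearMap.id
        (BalTensor.map (s : Module.End Aᵐᵒᵖ P.carrier) LinearMap.id t)) =
      (s : Module.End Aᵐᵒᵖ P.carrier)
        (cosepEval π P.carrier (BalTensor.map P.coact LinearMap.id t))
    rw [← BalTensor.map_comp_left, e, BalTensor.map_comp_left, cosepEval_natural]

end RComod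

/-! ### Right exactness of the cotensor product -/

section Cotensor

variable {A C : Type u} [Ring A] [AddCommGroup C] [Module A C] [Module Aᵐᵒᵖ C]
  [SMulCommClass A Aᵐᵒᵖ C] [Coring A C]

namespace LComod

/-- Cotensoring with `L` is right exact on short exact sequences of right comodules. -/
def IsCotensorRightExact (L : LComod A C) : Prop :=
  ∀ (K M N : RComod A C) (f : K ⟶ M) (g : M ⟶ N),
    Function.Injective f.toLinearMap → Function.Exact f.toLinearMap g.toLinearMap →
    Function.Surjective g.toLinearMap →
    Function.Exact (cotensorMap f L) (cotensorMap g L) ∧ Function.Surjective (cotensorMap g L)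

variable (L : LComod A C) (l : BalTensor A C L.carrier →ₗ[A] L.carrier)

section

variable (K : Type u) [AddCommGroup K] [Module Aᵐᵒᵖ K]

/-- The map `I_K ⊗ l` on `(K ⊗_A C) ⊗_A L`. -/
def splitMap : BalTensor A (BalTensor A K C) L.carrier →+ BalTensor A K L.carrier :=
  (BalTensor.map LinearMap.id l).comp (BalTensor.assoc A K C A L.carrier).symm.toAddMonoidHom

theorem splitMap_natural {K' : Type u} [AddCommGroup K'] [Module Aᵐᵒᵖ K'] (k : K →ₗ[Aᵐᵒᵖ] K')
    (s : BalTensor A (BalTensor A K C) L.carrier) :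
    splitMap L l K' (BalTensor.map (BalTensor.mapRight k) LinearMap.id s) =
      BalTensor.map k LinearMap.id (splitMap L l K s) :=
  BalTensor.hom_congr₂
    (f := (splitMap L l K').comp (BalTensor.map (BalTensor.mapRight k) LinearMap.id))
    (g := (BalTensor.map k LinearMap.id).comp (splitMap L l K)) (fun _ _ _ => rfl) s

theorem splitMap_cofreeCoact
    (hl : ∀ t, L.coact (l t) = BalTensor.map LinearMap.id l
      ((BalTensor.assoc A C C A L.carrier).symm
        (BalTensor.map (Coring.comul (A := A) (C := C)).right LinearMap.id t)))
    (s : BalTensor A (BalTensor A K C) L.carrier) :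
    splitMap L l (BalTensor A K C) (BalTensor.map (RComod.cofreeCoact K) LinearMap.id s) =
      BalTensor.assoc A K C A L.carrier
        (BalTensor.map LinearMap.id L.coact (splitMap L l K s)) := by
  refine BalTensor.hom_congr₂
    (f := (splitMap L l (BalTensor A K C)).comp
      (BalTensor.map (RComod.cofreeCoact K) LinearMap.id))
    (g := (BalTensor.assoc A K C A L.carrier).toAddMonoidHom.comp
      ((BalTensor.map LinearMap.id L.coact).comp (splitMap L l K))) (fun k c x => ?_) s
  change splitMap L l (BalTensor A K C) (BalTensor.tmul A (BalTensor.assoc A K C A C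
      (BalTensor.tmul A k ((Coring.comul (A := A) (C := C)).left c))) x) =
    BalTensor.assoc A K C A L.carrier (BalTensor.tmul A k (L.coact (l (BalTensor.tmul A c x))))
  rw [hl, BalTensor.map_tmul, BimodHom.right_apply]
  induction (Coring.comul (A := A) (C := C)).left c using BalTensor.induction_on with
  | hz => simp [BalTensor.tmul_zero, BalTensor.zero_tmul]
  | ht d d' => rfl
  | ha y z hy hz => simp only [BalTensor.tmul_add, BalTensor.add_tmul, map_add, hy, hz]

end

/-- The map `N ⊗_A L → N ⊗_A L`, `n ⊗ x ↦ n₀ ⊗ l(n₁ ⊗ x)`. -/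
def cotensorRetract (N : RComod A C) :
    BalTensor A N.carrier L.carrier →+ BalTensor A N.carrier L.carrier :=
  (splitMap L l N.carrier).comp (BalTensor.map N.coact LinearMap.id)

/-- Coassociativity of `N` and left colinearity of `l` give the equation of the cotensor product.
With `cotensorRetract_of_mem` and `cotensorRetract_natural`, the cotensor product is a natural
direct summand of `N ⊗_A L`. -/
theorem cotensorRetract_mem
    (hl : ∀ t, L.coact (l t) = BalTensor.map LinearMap.id l
      ((BalTensor.assoc A C C A L.carrier).symm
        (BalTensor.map (Coring.comul (A := A) (C := C)).right LinearMap.id t)))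
    (N : RComod A C) (t : BalTensor A N.carrier L.carrier) :
    cotensorRetract L l N t ∈ cotensor N L := by
  have e : BalTensor.mapRight (N := C) N.coact ∘ₗ N.coact =
      RComod.cofreeCoact N.carrier ∘ₗ N.coact :=
    LinearMap.ext fun n => (N.coassoc n).symm
  change BalTensor.map N.coact LinearMap.id
      (splitMap L l N.carrier (BalTensor.map N.coact LinearMap.id t)) =
    BalTensor.assoc A N.carrier C A L.carrier (BalTensor.map LinearMap.id L.coact
      (splitMap L l N.carrier (BalTensor.map N.coact LinearMap.id t)))
  rw [← splitMap_natural, ← BalTensor.map_comp_left, e, BalTensor.map_comp_left,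
    splitMap_cofreeCoact L l _ hl]

theorem cotensorRetract_of_mem (hlρ : ∀ x, l (L.coact x) = x) (N : RComod A C)
    (t : BalTensor A N.carrier L.carrier) (ht : t ∈ cotensor N L) :
    cotensorRetract L l N t = t := by
  have ht' : BalTensor.map N.coact LinearMap.id t =
    BalTensor.assoc A N.carrier C A L.carrier (BalTensor.map LinearMap.id L.coact t) := ht
  change BalTensor.map LinearMap.id l ((BalTensor.assoc A N.carrier C A L.carrier).symm
    (BalTensor.map N.coact LinearMap.id t)) = t
  rw [ht', AddEquiv.symm_apply_apply]
  exact BalTensor.hom_congr (f := (BalTensor.map LinearMap.id l).comp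
    (BalTensor.map LinearMap.id L.coact)) (g := AddMonoidHom.id _)
    (fun n x => congrArg (BalTensor.tmul A n) (hlρ x)) t

theorem cotensorRetract_natural {M N : RComod A C} (f : M ⟶ N)
    (t : BalTensor A M.carrier L.carrier) :
    cotensorRetract L l N (BalTensor.map f.toLinearMap LinearMap.id t) =
      BalTensor.map f.toLinearMap LinearMap.id (cotensorRetract L l M t) := by
  have e : N.coact ∘ₗ f.toLinearMap = BalTensor.mapRight (N := C) f.toLinearMap ∘ₗ M.coact :=
    LinearMap.ext f.colinear
  change splitMap L l N.carrier (BalTensor.map N.coact LinearMap.id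
      (BalTensor.map f.toLinearMap LinearMap.id t)) =
    BalTensor.map f.toLinearMap LinearMap.id
      (splitMap L l M.carrier (BalTensor.map M.coact LinearMap.id t))
  rw [← BalTensor.map_comp_left, e, BalTensor.map_comp_left, splitMap_natural]

variable {L}

/-- A natural retract of a right exact functor is right exact: find a preimage in the full tensor
product and project it with `cotensorRetract`. -/
theorem IsRelInjective.isCotensorRightExact (hL : L.IsRelInjective) :
    L.IsCotensorRightExact := by
  obtain ⟨l, hl, hlρ⟩ := hL
  intro K M N f g _ hfg hg
  refine ⟨fun t => ⟨fun ht => ?_, ?_⟩, fun t => ?_⟩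
  · obtain ⟨u, hu⟩ := (BalTensor.map_exact (N := L.carrier) hfg hg t.1).1 (congrArg Subtype.val ht)
    refine ⟨⟨cotensorRetract L l K u, cotensorRetract_mem L l hl K u⟩, Subtype.ext ?_⟩
    change BalTensor.map f.toLinearMap LinearMap.id (cotensorRetract L l K u) = t.1
    rw [← cotensorRetract_natural, hu, cotensorRetract_of_mem L l hlρ M t.1 t.2]
  · rintro ⟨u, rfl⟩
    exact Subtype.ext ((BalTensor.map_exact (N := L.carrier) hfg hg _).2 ⟨u.1, rfl⟩)
  · obtain ⟨u, hu⟩ := BalTensor.map_surjective (N := L.carrier) hg t.1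
    refine ⟨⟨cotensorRetract L l M u, cotensorRetract_mem L l hl M u⟩, Subtype.ext ?_⟩
    change BalTensor.map g.toLinearMap LinearMap.id (cotensorRetract L l M u) = t.1
    rw [← cotensorRetract_natural, hu, cotensorRetract_of_mem L l hlρ N t.1 t.2]

theorem IsCoflat.isCotensorRightExact (hL : L.IsCoflat) : L.IsCotensorRightExact :=
  fun K M N f g hf hfg hg => (hL K M N f g hf hfg hg).2

end LComod

end Cotensor

/-! ### Cotensoring with the dual as the functor of colinear maps -/

section DualCotensor

variable {A C : Type u} [Ring A]

theorem dualEval_map {M Y Z : Type u} [AddCommGroup M] [Module Aᵐᵒᵖ M] [AddCommGroup Y]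
    [Module Aᵐᵒᵖ Y] [AddCommGroup Z] [Module Aᵐᵒᵖ Z] (k : Y →ₗ[Aᵐᵒᵖ] Z)
    (t : BalTensor A Y (M →ₗ[Aᵐᵒᵖ] A)) :
    dualEval (BalTensor.map k LinearMap.id t) = k ∘ₗ dualEval t := by
  ext m
  induction t using BalTensor.induction_on with
  | hz => simp
  | ht y h => exact (map_smul k (MulOpposite.op (h m)) y).symm
  | ha y z hy hz =>
    simp only [LinearMap.comp_apply] at hy hz
    simp only [map_add, LinearMap.add_apply, LinearMap.comp_apply, hy, hz]

variable [AddCommGroup C] [Module A C] [Module Aᵐᵒᵖ C] [SMulCommClass A Aᵐᵒᵖ C] [Coring A C]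
variable (P : RComod A C) [Module.Finite Aᵐᵒᵖ P.carrier] [Module.Projective Aᵐᵒᵖ P.carrier]

/-- This unwinds the definition of the coaction on `P*`. Along with `dualEval_map`, it matches the
two maps defining the cotensor product with the two sides of the colinearity condition. -/
theorem dualEval_assoc {Y : Type u} [AddCommGroup Y] [Module Aᵐᵒᵖ Y]
    (t : BalTensor A Y (P.carrier →ₗ[Aᵐᵒᵖ] A)) (p : P.carrier) :
    dualEval (BalTensor.assoc A Y C A _ (BalTensor.map LinearMap.id (dualCoact P) t)) p =
      BalTensor.map (dualEval t) LinearMap.id (P.coact p) := by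
  have e : ∀ (y : Y) (u : BalTensor A C (P.carrier →ₗ[Aᵐᵒᵖ] A)),
      dualEval (BalTensor.assoc A Y C A _ (BalTensor.tmul A y u)) p =
        BalTensor.tmul A y (dualEval u p) := by
    intro y u
    induction u using BalTensor.induction_on with
    | hz => simp [BalTensor.tmul_zero]
    | ht d h => rfl
    | ha x z hx hz => simp only [BalTensor.tmul_add, map_add, LinearMap.add_apply, hx, hz]
  induction t using BalTensor.induction_on with
  | hz => simp [BalTensor.map_zero_left]
  | ht y h =>
    rw [BalTensor.map_tmul, e, dualEval_dualCoact, LinearMap.comp_apply]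
    induction P.coact p using BalTensor.induction_on with
    | hz => simp [BalTensor.tmul_zero]
    | ht m d => exact (BalTensor.smul_tmul A (h m) y d).symm
    | ha x z hx hz => simp only [BalTensor.tmul_add, map_add, hx, hz]
  | ha x z hx hz => simp only [map_add, LinearMap.add_apply, hx, hz, BalTensor.map_add_left]

/-- The elements of `N ⊗_A P*` in the cotensor product are those that correspond to colinear
maps `P → N`. -/
theorem mem_cotensor_dual_iff (N : RComod A C)
    (t : BalTensor A N.carrier (P.carrier →ₗ[Aᵐᵒᵖ] A)) :
    t ∈ cotensor N P.dual ↔ RComod.IsColinear (M := P) (N := N) (dualEval t) := by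
  change BalTensor.map N.coact LinearMap.id t =
    BalTensor.assoc A N.carrier C A _ (BalTensor.map LinearMap.id (dualCoact P) t) ↔ _
  rw [← dualEval_bijective.1.eq_iff, dualEval_map, LinearMap.ext_iff]
  exact forall_congr' fun p => by rw [dualEval_assoc]; rfl

namespace RComod

variable {P}

/-- Surjectivity of the cotensored map, read through `mem_cotensor_dual_iff`: `P` is projective
relative to short exact sequences of comodules. -/
theorem exists_colinear_lift (hP : P.dual.IsCotensorRightExact) {K M N : RComod A C} (f : K ⟶ M)
    (g : M ⟶ N) (hf : Function.Injective f.toLinearMap)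
    (hfg : Function.Exact f.toLinearMap g.toLinearMap) (hg : Function.Surjective g.toLinearMap)
    (h : colinearHom P N) : ∃ h' : colinearHom P M, g.toLinearMap ∘ₗ h'.1 = h.1 := by
  obtain ⟨t, ht⟩ := (dualEval_bijective (A := A)).2 h.1
  obtain ⟨s, hs⟩ := (hP K M N f g hf hfg hg).2
    ⟨t, (mem_cotensor_dual_iff P N t).2 (by rw [ht]; exact h.2)⟩
  have hs' : BalTensor.map g.toLinearMap LinearMap.id s.1 = t := congrArg Subtype.val hs
  refine ⟨⟨dualEval s.1, (mem_cotensor_dual_iff P M s.1).1 s.2⟩, ?_⟩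
  rw [← ht, ← hs']
  exact (dualEval_map _ _).symm

/-- An `A`-linear factorization through `K` is automatic, but its colinearity is not, since `f ⊗
I_C` need not be injective. It comes from exactness of the cotensored sequence in the middle. -/
theorem exists_colinear_factor (hP : P.dual.IsCotensorRightExact) {K M N : RComod A C} (f : K ⟶ M)
    (g : M ⟶ N) (hf : Function.Injective f.toLinearMap)
    (hfg : Function.Exact f.toLinearMap g.toLinearMap) (hg : Function.Surjective g.toLinearMap)
    (h : colinearHom P M) (hh : g.toLinearMap ∘ₗ h.1 = 0) :
    ∃ h' : colinearHom P K, f.toLinearMap ∘ₗ h'.1 = h.1 := by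
  obtain ⟨t, ht⟩ := (dualEval_bijective (A := A)).2 h.1
  have ht0 : BalTensor.map g.toLinearMap (LinearMap.id : (P.carrier →ₗ[Aᵐᵒᵖ] A) →ₗ[A] _) t = 0 := by
    apply dualEval_bijective.1
    rw [dualEval_map, ht, hh, map_zero]
  obtain ⟨s, hs⟩ := ((hP K M N f g hf hfg hg).1
    ⟨t, (mem_cotensor_dual_iff P M t).2 (by rw [ht]; exact h.2)⟩).1 (Subtype.ext ht0)
  have hs' : BalTensor.map f.toLinearMap LinearMap.id s.1 = t := congrArg Subtype.val hs
  refine ⟨⟨dualEval s.1, (mem_cotensor_dual_iff P K s.1).1 s.2⟩, ?_⟩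
  rw [← ht, ← hs']
  exact (dualEval_map _ _).symm

end RComod

end DualCotensor

namespace RComod

variable {A C : Type u} [Ring A] [AddCommGroup C] [Module A C] [Module Aᵐᵒᵖ C]
  [SMulCommClass A Aᵐᵒᵖ C] [Coring A C]
variable (P : RComod A C)

/-! ### The unit on free modules -/

section Free

variable (ι : Type u)

/-- The `i`-th coordinate map `S^(ι) ⊗_S P → P`. -/
noncomputable def freeCoord (i : ι) :
    BalTensor (endRing P) (ι →₀ (endRing P)ᵐᵒᵖ) P.carrier →ₗ[Aᵐᵒᵖ] P.carrier where
  toFun := BalTensor.lift' (fun x p => (x i).unop • p) (by simp [add_smul]) (by simp)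
    (by
      intro x s p
      exact mul_smul (x i).unop s p)
  map_add' := map_add _
  map_smul' a t := by
    induction t using BalTensor.induction_on with
    | hz => simp
    | ht x p => exact map_smul ((x i).unop : Module.End Aᵐᵒᵖ P.carrier) a p
    | ha x y hx hy => simp only [smul_add, map_add, hx, hy]

theorem freeCoord_tmul (i : ι) (x : ι →₀ (endRing P)ᵐᵒᵖ) (p : P.carrier) :
    freeCoord P ι i (BalTensor.tmul (endRing P) x p) = (x i).unop • p := rfl

theorem freeCoord_colinear (i : ι) :
    IsColinear (M := tensorEnd P (ι →₀ (endRing P)ᵐᵒᵖ)) (N := P) (freeCoord P ι i) := by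
  intro (t : BalTensor (endRing P) (ι →₀ (endRing P)ᵐᵒᵖ) P.carrier)
  change P.coact (freeCoord P ι i t) = BalTensor.map (freeCoord P ι i) LinearMap.id
      (tensorCoact (endRing P) (ι →₀ (endRing P)ᵐᵒᵖ) P (endRing_coact P) t)
  induction t using BalTensor.induction_on with
  | hz => simp only [map_zero]
  | ht x p =>
    rw [tensorCoact_tmul, ← BalTensor.map_comp_left]
    exact (x i).unop.2 p
  | ha x y hx hy => simp only [map_add, hx, hy]

/-- Elements of `S^(ι) ⊗_S P` have finite support. Allowing every larger `J'` makes it possible to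
treat several elements with one common finite set. -/
theorem exists_sum_freeCoord (t : BalTensor (endRing P) (ι →₀ (endRing P)ᵐᵒᵖ) P.carrier) :
    ∃ J : Finset ι, ∀ J' : Finset ι, J ⊆ J' →
      ∑ i ∈ J', BalTensor.tmul (endRing P) (Finsupp.single i 1) (freeCoord P ι i t) = t := by
  classical
  induction t using BalTensor.induction_on with
  | hz => exact ⟨∅, fun J' _ => Finset.sum_eq_zero fun i _ => by simp [BalTensor.tmul_zero]⟩
  | ht x p =>
    refine ⟨x.support, fun J' hJ => ?_⟩
    have e : ∑ i ∈ J', Finsupp.single i (x i) = x := by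
      rw [← Finsupp.sum_of_support_subset x hJ (fun i s => Finsupp.single i s) (by simp)]
      exact x.sum_single
    conv_rhs => rw [← e, BalTensor.sum_tmul]
    refine Finset.sum_congr rfl fun i _ => ?_
    rw [freeCoord_tmul, ← BalTensor.smul_tmul, Finsupp.smul_single, MulOpposite.op_unop,
      smul_eq_mul, mul_one]
  | ha y z hy hz =>
    obtain ⟨J, hJ⟩ := hy
    obtain ⟨L, hL⟩ := hz
    refine ⟨J ∪ L, fun J' hJ' => ?_⟩
    simp only [map_add, BalTensor.tmul_add, Finset.sum_add_distrib]
    rw [hJ J' (Finset.union_subset_left hJ'), hL J' (Finset.union_subset_right hJ')]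

/-- Coordinates detect zero because `S` acts faithfully on `P`. A colinear map from the finitely
generated `P` into `S^(ι) ⊗_S P` meets only finitely many coordinates, each of which is an element
of `S`. -/
theorem unitMap_bijective_free [Module.Finite Aᵐᵒᵖ P.carrier] :
    Function.Bijective (unitMap P (ι →₀ (endRing P)ᵐᵒᵖ)) := by
  classical
  constructor
  · rw [injective_iff_map_eq_zero]
    intro x hx
    ext1 i
    apply MulOpposite.unop_injective
    apply Subtype.ext
    ext p
    have h := congrArg (freeCoord P ι i) (LinearMap.congr_fun (congrArg Subtype.val hx) p)
    exact h.trans (map_zero (freeCoord P ι i))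
  · intro f
    let g : P.carrier →ₗ[Aᵐᵒᵖ] BalTensor (endRing P) (ι →₀ (endRing P)ᵐᵒᵖ) P.carrier := f.1
    obtain ⟨s, hs⟩ := Module.Finite.fg_top (R := Aᵐᵒᵖ) (M := P.carrier)
    choose J hJ using exists_sum_freeCoord P ι
    -- A finite set of indices that serves all generators of `P` at once, hence all of `P` by
    -- linearity.
    let I : Finset ι := s.biUnion fun p => J (g p)
    have hg : ∑ i ∈ I, BalTensor.tmulLeft (endRing P) (Finsupp.single i 1) ∘ₗ
        freeCoord P ι i ∘ₗ g = g := by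
      refine LinearMap.ext_on hs fun p hp => ?_
      rw [LinearMap.sum_apply]
      exact hJ (g p) I (Finset.subset_biUnion_of_mem (fun p => J (g p)) hp)
    let σ : ι → endRing P := fun i => ⟨freeCoord P ι i ∘ₗ g,
      isColinear_comp (L := P) (M := tensorEnd P (ι →₀ (endRing P)ᵐᵒᵖ)) (N := P)
        (freeCoord_colinear P ι i) f.2⟩
    refine ⟨∑ i ∈ I, Finsupp.single i (MulOpposite.op (σ i)), Subtype.ext (LinearMap.ext fun p => ?_)⟩
    change BalTensor.tmul (endRing P) (∑ i ∈ I, Finsupp.single i (MulOpposite.op (σ i))) p = g p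
    conv_rhs => rw [← hg, LinearMap.sum_apply]
    rw [BalTensor.sum_tmul]
    refine Finset.sum_congr rfl fun i _ => ?_
    change _ = BalTensor.tmul (endRing P) (Finsupp.single i 1) (σ i • p)
    rw [← BalTensor.smul_tmul, Finsupp.smul_single, smul_eq_mul, mul_one]

end Free

/-! ### The unit over a flat comodule, by free presentations -/

section Flat

variable {P} [Module.Finite Aᵐᵒᵖ P.carrier] [Module.Projective Aᵐᵒᵖ P.carrier]

/-- The colinear map `f ⊗ I_P`. -/
def tensorHom {X Y : Type u} [AddCommGroup X]
    [Module (endRing P)ᵐᵒᵖ X] [AddCommGroup Y] [Module (endRing P)ᵐᵒᵖ Y]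
    (f : X →ₗ[(endRing P)ᵐᵒᵖ] Y) : tensorEnd P X ⟶ tensorEnd P Y :=
  ⟨BalTensor.mapRight (N := P.carrier) f, tensorCoact_natural P f⟩

section Exact

variable {Y F X : Type u} [AddCommGroup Y] [Module (endRing P)ᵐᵒᵖ Y] [AddCommGroup F]
  [Module (endRing P)ᵐᵒᵖ F] [AddCommGroup X] [Module (endRing P)ᵐᵒᵖ X]
  {i : Y →ₗ[(endRing P)ᵐᵒᵖ] F} {q : F →ₗ[(endRing P)ᵐᵒᵖ] X}

/-- Flatness makes the tensored sequence a short exact sequence of comodules. A colinear map into `X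
⊗_S P` then lifts to `F ⊗_S P`, where it comes from an element of `F`. -/
theorem unitMap_surjective_of_exact (hf : IsFlatLeft P.endRing P.carrier)
    (hP : P.dual.IsCotensorRightExact) (hi : Function.Injective i) (hiq : Function.Exact i q)
    (hq : Function.Surjective q) (hF : Function.Surjective (unitMap P F)) :
    Function.Surjective (unitMap P X) := by
  intro h
  obtain ⟨h', hh'⟩ := exists_colinear_lift hP (tensorHom i) (tensorHom q) (hf Y F i hi)
    (BalTensor.map_exact hiq hq) (BalTensor.map_surjective hq) h
  obtain ⟨z, rfl⟩ := hF h'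
  exact ⟨q z, Subtype.ext hh'⟩

/-- If `z ⊗ -` vanishes in `X ⊗_S P`, it factors colinearly through `Y ⊗_S P`, and surjectivity for
`Y` shows that `z` comes from `Y`. -/
theorem unitMap_injective_of_exact (hf : IsFlatLeft P.endRing P.carrier)
    (hP : P.dual.IsCotensorRightExact) (hi : Function.Injective i) (hiq : Function.Exact i q)
    (hq : Function.Surjective q) (hF : Function.Injective (unitMap P F))
    (hY : Function.Surjective (unitMap P Y)) : Function.Injective (unitMap P X) := by
  rw [injective_iff_map_eq_zero]
  intro x hx
  obtain ⟨z, rfl⟩ := hq x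
  obtain ⟨h', hh'⟩ := exists_colinear_factor hP (tensorHom i) (tensorHom q) (hf Y F i hi)
    (BalTensor.map_exact hiq hq) (BalTensor.map_surjective hq) (unitMap P F z)
    (congrArg Subtype.val hx)
  obtain ⟨y, rfl⟩ := hY h'
  have e : i y = z := hF (Subtype.ext hh')
  rw [← e, hiq.apply_apply_eq_zero]

end Exact

/-- The presentation is that of `X` by the free module on its own elements. Surjectivity is settled
for all modules first, because injectivity for `X` uses it for the kernel of the presentation. -/
theorem unitMap_bijective_of_isFlatLeft (hf : IsFlatLeft P.endRing P.carrier)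
    (hP : P.dual.IsCotensorRightExact) (X : Type u) [AddCommGroup X]
    [Module (endRing P)ᵐᵒᵖ X] : Function.Bijective (unitMap P X) := by
  have hsurj : ∀ (X : Type u) [AddCommGroup X] [Module (endRing P)ᵐᵒᵖ X],
      Function.Surjective (unitMap P X) := fun X _ _ =>
    unitMap_surjective_of_exact hf hP (Submodule.subtype_injective _)
      (LinearMap.exact_subtype_ker_map _)
      (Finsupp.linearCombination_id_surjective (endRing P)ᵐᵒᵖ X) (unitMap_bijective_free P X).2
  exact ⟨unitMap_injective_of_exact hf hP (Submodule.subtype_injective _)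
    (LinearMap.exact_subtype_ker_map _)
    (Finsupp.linearCombination_id_surjective (endRing P)ᵐᵒᵖ X) (unitMap_bijective_free P X).1
    (hsurj _), hsurj X⟩

end Flat

end RComod

/-! ### The equivalence of categories -/

theorem mainTheorem4 {A C : Type u} [Ring A] [AddCommGroup C] [Module A C] [Module Aᵐᵒᵖ C]
    [SMulCommClass A Aᵐᵒᵖ C] [Coring A C] (P : RComod A C)
    [Module.Finite Aᵐᵒᵖ P.carrier] [Module.Projective Aᵐᵒᵖ P.carrier] (hP : P.IsGalois)
    (h : P.IsStronglyRelInjective ∨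
      (P.dual.IsRelInjective ∧ IsFlatLeft P.endRing P.carrier) ∨
      (P.dual.IsCoflat ∧ IsFlatLeft P.endRing P.carrier) ∨
      IsCoseparable A C) :
    ∃ e : RComod A C ≌ ModuleCat.{u} (P.endRing)ᵐᵒᵖ,
      e.functor = P.homFunctor ∧ e.inverse = P.tensorFunctor := by
  -- The four cases collapse to two: a splitting of the coaction of `P`, or right exact cotensoring
  -- with `P*` together with flatness.
  have h' : P.IsStronglyRelInjective ∨
      (P.dual.IsCotensorRightExact ∧ IsFlatLeft P.endRing P.carrier) := by
    rcases h with h | h | h | h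
    · exact Or.inl h
    · exact Or.inr ⟨h.1.isCotensorRightExact, h.2⟩
    · exact Or.inr ⟨h.1.isCotensorRightExact, h.2⟩
    · exact Or.inl (P.isStronglyRelInjective_of_isCoseparable h)
  rcases h' with ⟨l, hl, hlρ, hlS⟩ | ⟨hc, hf⟩
  · exact RComod.exists_equivalence P
      (RComod.counitMap_bijective_of_splitting P l hP hlS hl hlρ)
      (fun X _ _ => RComod.unitMap_bijective_of_splitting P l X hlS hl hlρ)
  · exact RComod.exists_equivalence P (RComod.counitMap_bijective_of_isFlatLeft P hP hf)
      (fun X _ _ => RComod.unitMap_bijective_of_isFlatLeft hf hc X)
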